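/- **Setting.** A server (party $0$) with parameters $w_0\in\mathbb R^{d_0}$ and $M$ clients with parameters $w_m\in\mathbb R^{d_m}$, $d_m\ge 1$, $m=1,\dots,M$, minimize $$f(w)=\frac1n\sum_{i=1}^n f_i(w),\qquad f_i(w)=\mathcal L\bigl(F_0(w_0,F_1(w_1;x_{i,1}),\dots,F_M(w_M;x_{i,M})),y_i\bigr)+\lambda\sum_{m=0}^M g_m(w_m),$$ where $w=(w_0,\dots,w_M)$ and all norms are Euclidean. **Algorithm.** At round $t=0,1,\dots$ an active client $m_t$, a sample $i_t$ and random directions $u_t=(u_{t,1},\dots,u_{t,M})$, with $u_{t,m}$ uniformly distributed on the unit sphere of $\mathbb R^{d_m}$, are drawn. The variables $m_t$, $i_t$, $u_t$ are mutually independent and jointly independent of everything that happened before round $t$; $\mathbb P(m_t=m)=p_m>0$ and $\mathbb P(i_t=i)=q_i$. Let $\tilde w^t=(w_0^t,w_1^{t-\tau^t_1},\dots,w_M^{t-\tau^t_M})$ (with $w^s:=w^0$ for $s<0$) be the delayed parameters, where the delays $\tau^t_m\in\{0,1,\dots,\tau\}$ may depend on $i_t$, on $m_t$ and on what happened before round $t$.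 Then $$w_0^{t+1}=w_0^t-\eta\nabla_{w_0}f_{i_t}(\tilde w^t),\qquad w_{m_t}^{t+1}=w_{m_t}^t-\eta\,\frac{d_{m_t}}{\mu}\bigl[f_{i_t}(\tilde w^t\text{ with }\tilde w_{m_t}^t+\mu u_{t,m_t}\text{ as block }m_t)-f_{i_t}(\tilde w^t)\bigr]u_{t,m_t},$$ and the other clients do not move. The initial $w^0$ may be random, with $\mathbb E|f(w^0)|<\infty$. **Assumptions.** (1) $f^*=\inf f>-\infty$. (2) Each $f_i$ is differentiable, $\nabla f_i$ is $L$-Lipschitz and $\nabla_{w_m}f_i$ is $L_m$-Lipschitz in $w$, with $L_m>0$, $m=0,\dots,M$. (3) $\sum_i q_i\nabla_{w_m}f_i(w)=\nabla_{w_m}f(w)$ for all $w$ and $m=0,\dots,M$. (4) $\sum_i q_i\|\nabla_{w_m}f_i(w)-\nabla_{w_m}f(w)\|^2\le\sigma_m^2$, $\sigma_m\ge0$, for all $w$ and $m=0,\dots,M$. (5) $\|\nabla_{w_m}f_i(w)\|\le G_m$ for all $i$, $w$ and all clients $m=1,\dots,M$. Put $L_*=\max\{L,L_0,\dots,L_M\}$,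 $d_*=\max_{1\le m\le M}d_m$, $p_*=1/\min_m p_m$, $\sigma_*=\max_{0\le m\le M}\sigma_m$, $G_*=\max_m G_m$, $f^0=f(w^0)$. **Corollary.** If $T\ge1$, $\eta=\mu=\frac1{\sqrt T}$ and $\eta\le\frac1{4L_*d_*}$, then $\mathbb E\|\nabla f(w^t)\|^2<\infty$ for $t<T$ and $$\begin{aligned}\frac1T\sum_{t=0}^{T-1}\mathbb E\|\nabla f(w^t)\|^2\le{}&\frac1{\sqrt T}\bigl[4p_*\mathbb E(f^0-f^*)+4p_*L_*\sigma_*^2+8p_*L_*d_*\sigma_*^2\bigr]\\&+\frac1T\bigl(18p_*\tau^2L_*^2d_*G_*^2+5p_*\tau^2\mu^2L_*^4d_*^2+p_*L_*^2d_*^2\bigr)+\frac1{T^{3/2}}\,p_*L_*^3d_*^2 .\end{aligned}$$ Consequently $\frac1T\sum_{t=0}^{T-1}\mathbb E\|\nabla f(w^t)\|^2\le C\,\frac{d_*}{\sqrt T}$, where $C$ depends only on $p_*$, $\mathbb E(f^0-f^*)$, $L_*$, $\sigma_*$, $G_*$ and $\tau$, and not on $T$, $M$, $n$ or the dimensions;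 in particular it does not depend on the size $d_0$ of the server model other than through these quantities. -/

import Mathlib

open MeasureTheory ProbabilityTheory

/-- A block of real parameters of size `k`, with the Euclidean norm. -/
abbrev Block (k : ℕ) : Type := EuclideanSpace ℝ (Fin k)

/-- All parameters `[w_0, w_1, …, w_M]`, with the Euclidean norm `‖w‖² = ∑ₘ ‖w_m‖²`.
Party `0` is the server, party `m.succ` is the client with index `m : Fin M`;
`d m` is the number of parameters of party `m`. -/
abbrev Params {M : ℕ} (d : Fin (M + 1) → ℕ) : Type :=
  PiLp 2 (fun m : Fin (M + 1) => Block (d m))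

/-- `w` with the block of party `m` replaced by `v`. -/
def setBlock {M : ℕ} {d : Fin (M + 1) → ℕ} (w : Params d) (m : Fin (M + 1))
    (v : Block (d m)) : Params d :=
  WithLp.toLp 2 (Function.update (fun k => w k) m v)

/-- The partial gradient `∇_{w_m} F (w)` of `F` in the block of party `m`. -/
noncomputable def partialGradient {M : ℕ} {d : Fin (M + 1) → ℕ} (F : Params d → ℝ)
    (m : Fin (M + 1)) (w : Params d) : Block (d m) :=
  gradient (fun v => F (setBlock w m v)) (w m)

/-- The uniform probability distribution on the unit sphere of `ℝᵏ` (for `1 ≤ k`),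
as a measure on `ℝᵏ`. -/
noncomputable def uniformSphere (k : ℕ) : Measure (Block k) :=
  (((volume : Measure (Block k)).toSphere Set.univ)⁻¹ •
    (volume : Measure (Block k)).toSphere).map Subtype.val

universe u v

/-- A vertical federated learning problem with one server, `M` clients and `n` samples.
The embeddings, the features, the labels and the predictions live in arbitrary types. -/
structure VFLProblem (M n : ℕ) (d : Fin (M + 1) → ℕ) where
  /-- the features held by each client -/
  Feature : Fin M → Type u
  /-- the output of each client model -/
  Embedding : Fin M → Type u
  /-- the output of the server model -/
  Prediction : Type u
  /-- the labels -/
  Label : Type u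
  /-- `x i m` is the feature of sample `i` held by client `m` -/
  x : Fin n → ∀ m, Feature m
  /-- `y i` is the label of sample `i`, held by the server -/
  y : Fin n → Label
  /-- the client models `F_m (w_m; x_{i,m})` -/
  clientModel : ∀ m : Fin M, Block (d m.succ) → Feature m → Embedding m
  /-- the server model `F_0 (w_0; c_1, …, c_M)` -/
  serverModel : Block (d 0) → (∀ m, Embedding m) → Prediction
  /-- the loss `𝓛 (ŷ, y)` -/
  loss : Prediction → Label → ℝ
  /-- the weight `λ` of the regularization -/
  regWeight : ℝ
  /-- the regularization function of each party -/
  reg : ∀ m : Fin (M + 1), Block (d m) → ℝ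

namespace VFLProblem

variable {M n : ℕ} {d : Fin (M + 1) → ℕ}

/-- The loss `f_i (w_0, w)` of sample `i`. -/
def sampleLoss (V : VFLProblem.{u} M n d) (i : Fin n) (w : Params d) : ℝ :=
  V.loss (V.serverModel (w 0) (fun m => V.clientModel m (w m.succ) (V.x i m))) (V.y i)
    + V.regWeight * ∑ m, V.reg m (w m)

/-- The objective `f = (1/n) ∑ᵢ f_i`. -/
noncomputable def objective (V : VFLProblem.{u} M n d) (w : Params d) : ℝ :=
  (1 / (n : ℝ)) * ∑ i, V.sampleLoss i w

/-- The optimal value `f^* = inf f`. -/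
noncomputable def optimalValue (V : VFLProblem.{u} M n d) : ℝ :=
  ⨅ w : Params d, V.objective w

/-- Feasible optimal solution: `f` is bounded below. -/
def FeasibleOptimum (V : VFLProblem.{u} M n d) : Prop :=
  BddBelow (Set.range V.objective)

/-- Lipschitz gradient: every `f_i` is differentiable, its gradient is `L`-Lipschitz, and its
partial gradient for party `m` is `Lb m`-Lipschitz with `Lb m > 0`, in all the parameters. -/
def LipschitzGradient (V : VFLProblem.{u} M n d) (L : ℝ) (Lb : Fin (M + 1) → ℝ) : Prop :=
  (∀ i, Differentiable ℝ (V.sampleLoss i)) ∧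
  (∀ i w w', ‖gradient (V.sampleLoss i) w - gradient (V.sampleLoss i) w'‖ ≤ L * ‖w - w'‖) ∧
  (∀ m, 0 < Lb m) ∧
  (∀ i m w w', ‖partialGradient (V.sampleLoss i) m w - partialGradient (V.sampleLoss i) m w'‖
    ≤ Lb m * ‖w - w'‖)

/-- Unbiased gradient, for a random sample which is `i` with probability `q i`. -/
def UnbiasedGradient (V : VFLProblem.{u} M n d) (q : Fin n → ℝ) : Prop :=
  ∀ m w, ∑ i, q i • partialGradient (V.sampleLoss i) m w = partialGradient V.objective m w

/-- Bounded variance, for a random sample which is `i` with probability `q i`. -/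
def BoundedVariance (V : VFLProblem.{u} M n d) (q : Fin n → ℝ) (σ : Fin (M + 1) → ℝ) : Prop :=
  (∀ m, 0 ≤ σ m) ∧
  ∀ m w, ∑ i, q i * ‖partialGradient (V.sampleLoss i) m w - partialGradient V.objective m w‖ ^ 2
    ≤ σ m ^ 2

/-- Bounded block-coordinate gradient, for all the clients. -/
def BoundedClientGradient (V : VFLProblem.{u} M n d) (G : Fin M → ℝ) : Prop :=
  ∀ i (m : Fin M) w, ‖partialGradient (V.sampleLoss i) m.succ w‖ ≤ G m

/-- The two-point gradient estimator for the parameters of client `m` at `w`, with smoothing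
parameter `μ`, direction `dir`, and the factor `φ(d_m) = d_m` of the unit sphere. -/
noncomputable def zoGradient (V : VFLProblem.{u} M n d) (i : Fin n) (m : Fin M) (μ : ℝ)
    (w : Params d) (dir : Block (d m.succ)) : Block (d m.succ) :=
  ((d m.succ : ℝ) / μ *
    (V.sampleLoss i (setBlock w m.succ (w m.succ + μ • dir)) - V.sampleLoss i w)) • dir

end VFLProblem

/-- The parameters that the server sees at round `t`: its own ones are up to date, those of
client `m` are `τ m` rounds old. What is older than the start is the initial value. -/
def delayedParams {M : ℕ} {d : Fin (M + 1) → ℕ} (w : ℕ → Params d) (t : ℕ)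
    (τ : Fin M → ℕ) : Params d :=
  WithLp.toLp 2 (Fin.cons (w t 0) (fun m => w (t - τ m) m.succ) : ∀ m, Block (d m))

/-- A run of the asynchronous cascaded hybrid method on the probability space `(Ω, P)`.
At round `t` the client `act t` is active and picks the sample `smp t`; it moves by a
zeroth-order step along its random direction `dir t (act t)`, the server moves by a first-order
step, and both use the delayed parameters. `delay t a i m` is the delay at round `t` of
client `m` for sample `i` in case the client `a` is the active one. (So the own entry of the
active client may be fresh or delayed.) `ℱ t` is the information available before round `t`. -/
structure IsRun {M n : ℕ} {d : Fin (M + 1) → ℕ} (V : VFLProblem.{u} M n d)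
    (η : Fin (M + 1) → ℝ) (μ : Fin M → ℝ) (p : Fin M → ℝ) (q : Fin n → ℝ)
    {Ω : Type v} [mΩ : MeasurableSpace Ω] (P : Measure Ω) (ℱ : Filtration ℕ mΩ)
    (act : ℕ → Ω → Fin M) (smp : ℕ → Ω → Fin n)
    (dir : ℕ → Ω → (m : Fin M) → Block (d m.succ))
    (delay : ℕ → Ω → Fin M → Fin n → Fin M → ℕ)
    (w : ℕ → Ω → Params d) : Prop where
  /-- the initial parameters, and the delays, are known before the round -/
  init_measurable : Measurable[ℱ 0] (w 0)
  delay_measurable : ∀ t a i m, Measurable[ℱ t] (fun ω => delay t ω a i m)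
  /-- the choices of round `t` are known after it -/
  act_measurable : ∀ t, Measurable[ℱ (t + 1)] (act t)
  smp_measurable : ∀ t, Measurable[ℱ (t + 1)] (smp t)
  dir_measurable : ∀ t, Measurable[ℱ (t + 1)] (dir t)
  /-- the choices of round `t` are independent of all that happened before -/
  indep_past : ∀ t, Indep
    (MeasurableSpace.comap (fun ω => (act t ω, smp t ω, dir t ω)) inferInstance) (ℱ t) P
  /-- active client, sample and direction of a round are mutually independent -/
  indep_act_smp : ∀ t, IndepFun (act t) (smp t) P
  indep_dir : ∀ t, IndepFun (fun ω => (act t ω, smp t ω)) (dir t) P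
  /-- the laws of active client, sample and directions -/
  act_law : ∀ t m, P.real {ω | act t ω = m} = p m
  smp_law : ∀ t i, P.real {ω | smp t ω = i} = q i
  dir_law : ∀ t m, P.map (fun ω => dir t ω m) = uniformSphere (d m.succ)
  /-- first-order step of the server -/
  server_step : ∀ t ω, w (t + 1) ω 0 = w t ω 0 - η 0 •
    partialGradient (V.sampleLoss (smp t ω)) 0
      (delayedParams (fun s => w s ω) t (delay t ω (act t ω) (smp t ω)))
  /-- zeroth-order step of the active client -/
  client_step : ∀ t ω, w (t + 1) ω (act t ω).succ = w t ω (act t ω).succ - η (act t ω).succ •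
    V.zoGradient (smp t ω) (act t ω) (μ (act t ω))
      (delayedParams (fun s => w s ω) t (delay t ω (act t ω) (smp t ω)))
      (dir t ω (act t ω))
  /-- the other clients do not move -/
  idle_step : ∀ t ω m, m ≠ act t ω → w (t + 1) ω m.succ = w t ω m.succ

/-- `L_* = max {L, L_0, …, L_M}`. -/
noncomputable def maxLipschitz {M : ℕ} (L : ℝ) (Lb : Fin (M + 1) → ℝ) : ℝ := max L (⨆ m, Lb m)

/-- `d_*`, the largest parameter dimension of a client. -/
noncomputable def maxClientDim {M : ℕ} (d : Fin (M + 1) → ℕ) : ℕ := ⨆ m : Fin M, d m.succ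

/-- `p_*`, where `1 / p_* = min_m p_m`. -/
noncomputable def invMinProb {M : ℕ} (p : Fin M → ℝ) : ℝ := (⨅ m, p m)⁻¹

/-!
The proof follows the expected decrease of the objective `f` in one round.

Since `f` has a Lipschitz gradient, `f (w^{t+1})` is at most
`f (w^t) + ⟨∇f (w^t), Δw⟩ + L_* ‖Δw‖² / 2`, where `Δw` has one block for the server and one for
the active client. The uniform distribution on the unit sphere of `ℝᵏ` is isotropic
(`integral_inner_mul_inner`), so the two-point estimator equals an unbiased estimator of the
partial gradient up to an error of norm at most `k L_* μ / 2`, and its second moment is at most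
`2 k ‖∇‖² + k² L_*² μ² / 2` (`integral_inner_twoPoint_ge`, `integral_norm_twoPoint_sq_le`).
Each sampled gradient at the delayed parameters is written as true gradient + sampling noise
+ delay error. The delays may depend on the sample, hence the noise is taken at the current
parameters, where its mean over the sample vanishes, and everything else is bounded for each
sample separately (`client_quadratic_bound`, `server_quadratic_bound`). For
`η ≤ 1 / (4 L_* d_*)` this gives a decrease of `η ‖∇f‖² / (4 p_*)`, up to explicit errors
(`VFLProblem.UniformBounds.sum_integral_objective_hybridStep_le`).

The delay error is at most `L_*²` times `τ` times the squared displacements of the clients in the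
last `τ` rounds, each of which has expectation at most `η²` times the second moment of the
estimator, as the gradients of the clients are bounded (`IsRun.lintegral_delay_error_le`).

The choices of a round are independent of the past, so expectations are iterated integrals
(`IsRun.lintegral_eq_sum_choice`). The gap `f (w^t) - f^*` is nonnegative, so the decrease is
stated with integrals in `[0, ∞]` (`IsRun.lintegral_objective_succ_add_le`), and
telescoping needs no integrability except that of `f (w^0)`: it yields at once that the gradients
are square integrable and the bound on the sum of their second moments
(`IsRun.integrable_and_sum_integral_le`).
-/

/-! ### The uniform distribution on the sphere -/

theorem isProbabilityMeasure_uniformSphere {k : ℕ} (hk : 1 ≤ k) :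
    IsProbabilityMeasure (uniformSphere k) := by
  have : Nonempty (Fin k) := ⟨⟨0, hk⟩⟩
  have : Nontrivial (Block k) := inferInstance
  have h0 : (volume : Measure (Block k)).toSphere ≠ 0 := Measure.toSphere_ne_zero _
  have : NeZero (volume : Measure (Block k)).toSphere := ⟨h0⟩
  unfold uniformSphere
  exact Measure.isProbabilityMeasure_map measurable_subtype_coe.aemeasurable

theorem ae_uniformSphere_norm (k : ℕ) : ∀ᵐ u ∂(uniformSphere k), ‖u‖ = 1 := by
  unfold uniformSphere
  rw [ae_map_iff measurable_subtype_coe.aemeasurable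
    (measurableSet_eq_fun measurable_norm measurable_const)]
  exact Filter.Eventually.of_forall fun u => by simp

open scoped Pointwise in
theorem uniformSphere_apply {k : ℕ} {S : Set (Block k)} (hS : MeasurableSet S) :
    uniformSphere k S = ((volume : Measure (Block k)).toSphere Set.univ)⁻¹ *
      (k * volume (Set.Ioo (0 : ℝ) 1 • (S ∩ Metric.sphere (0 : Block k) 1))) := by
  unfold uniformSphere
  rw [Measure.map_apply measurable_subtype_coe hS, Measure.smul_apply,
    Measure.toSphere_apply' _ (measurable_subtype_coe hS), smul_eq_mul,
    Subtype.image_preimage_coe, Set.inter_comm]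
  simp

open scoped Pointwise in
/-- The uniform distribution on the sphere is invariant under linear isometries, since the cone
over a rotated part of the sphere is the rotated cone. -/
theorem map_uniformSphere {k : ℕ} (A : Block k ≃ₗᵢ[ℝ] Block k) :
    (uniformSphere k).map A = uniformSphere k := by
  ext S hS
  rw [Measure.map_apply A.continuous.measurable hS,
    uniformSphere_apply (A.continuous.measurable hS), uniformSphere_apply hS]
  have : Set.Ioo (0 : ℝ) 1 • (A ⁻¹' S ∩ Metric.sphere (0 : Block k) 1)
      = A ⁻¹' (Set.Ioo (0 : ℝ) 1 • (S ∩ Metric.sphere (0 : Block k) 1)) := by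
    ext x
    simp only [Set.mem_smul, Set.mem_inter_iff, Set.mem_preimage, mem_sphere_zero_iff_norm]
    constructor
    · rintro ⟨r, hr, y, ⟨hy, hy1⟩, rfl⟩
      exact ⟨r, hr, A y, ⟨hy, by simpa using hy1⟩, by simp⟩
    · rintro ⟨r, hr, y, ⟨hy, hy1⟩, h⟩
      refine ⟨r, hr, A.symm y, ⟨by simpa using hy, by simpa using hy1⟩, ?_⟩
      rw [← map_smul, h]; simp
  rw [this]
  congr 2
  exact A.measurePreserving.measure_preimage_equiv (f := A.toMeasurableEquiv) _

/-- A continuous function is integrable over the sphere. -/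
theorem Continuous.integrable_uniformSphere {k : ℕ} (hk : 1 ≤ k) {h : Block k → ℝ}
    (hc : Continuous h) : Integrable h (uniformSphere k) := by
  have := isProbabilityMeasure_uniformSphere hk
  obtain ⟨C, hC⟩ := (isCompact_sphere (0 : Block k) 1).exists_bound_of_continuousOn hc.continuousOn
  refine Integrable.of_bound hc.aestronglyMeasurable C ?_
  filter_upwards [ae_uniformSphere_norm k] with u hu
  exact hC u (by simpa using hu)

theorem integral_inner_sq_eq_of_norm_eq {k : ℕ} {x y : Block k} (h : ‖x‖ = ‖y‖) :
    ∫ u, (inner ℝ x u) ^ 2 ∂(uniformSphere k) = ∫ u, (inner ℝ y u) ^ 2 ∂(uniformSphere k) := by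
  set A := (ℝ ∙ (x - y))ᗮ.reflection
  have hA : A x = y := Submodule.reflection_sub h
  conv_rhs => rw [← map_uniformSphere A]
  rw [integral_map A.continuous.measurable.aemeasurable
    (Continuous.aestronglyMeasurable (by fun_prop))]
  simp_rw [← hA, LinearIsometryEquiv.inner_map_map]

theorem integral_inner_sq {k : ℕ} (hk : 1 ≤ k) (x : Block k) :
    ∫ u, (inner ℝ x u) ^ 2 ∂(uniformSphere k) = ‖x‖ ^ 2 / k := by
  have := isProbabilityMeasure_uniformSphere hk
  have hk0 : (k : ℝ) ≠ 0 := by positivity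
  have hsum : ∑ j : Fin k, ∫ u, (inner ℝ (EuclideanSpace.single j (1 : ℝ)) u) ^ 2
      ∂(uniformSphere k) = 1 := by
    rw [← integral_finsetSum _ fun j _ =>
      Continuous.integrable_uniformSphere hk (by fun_prop)]
    rw [integral_congr_ae (g := fun _ => (1 : ℝ))]
    · simp
    · filter_upwards [ae_uniformSphere_norm k] with u hu
      have := EuclideanSpace.norm_sq_eq u
      rw [hu] at this
      simpa [EuclideanSpace.inner_single_left] using this.symm
  have hone : ∀ y : Block k, ‖y‖ = 1 → ∫ u, (inner ℝ y u) ^ 2 ∂(uniformSphere k) = 1 / k := by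
    intro y hy
    rw [Finset.sum_congr rfl fun j _ => integral_inner_sq_eq_of_norm_eq (k := k)
      (x := EuclideanSpace.single j (1 : ℝ)) (y := y) (by simp [hy])] at hsum
    simp only [Finset.sum_const, Finset.card_univ, Fintype.card_fin, nsmul_eq_mul] at hsum
    field_simp
    linarith
  rcases eq_or_ne x 0 with rfl | hx
  · simp
  have hx' : ‖x‖ ≠ 0 := norm_ne_zero_iff.mpr hx
  have h1 := hone (‖x‖⁻¹ • x) (by rw [norm_smul, norm_inv, norm_norm, inv_mul_cancel₀ hx'])
  simp_rw [real_inner_smul_left, mul_pow, integral_const_mul] at h1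
  field_simp at h1 ⊢
  linarith

/-- The uniform distribution on the sphere is isotropic: `k 𝔼[u uᵀ]` is the identity. -/
theorem integral_inner_mul_inner {k : ℕ} (hk : 1 ≤ k) (x y : Block k) :
    ∫ u, inner ℝ x u * inner ℝ y u ∂(uniformSphere k) = inner ℝ x y / k := by
  have h1 := integral_inner_sq hk (x + y)
  have h2 := integral_inner_sq hk (x - y)
  have h3 : ∫ u, inner ℝ x u * inner ℝ y u ∂(uniformSphere k)
      = (∫ u, (inner ℝ (x + y) u) ^ 2 ∂(uniformSphere k)
        - ∫ u, (inner ℝ (x - y) u) ^ 2 ∂(uniformSphere k)) / 4 := by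
    rw [← integral_sub (Continuous.integrable_uniformSphere hk (by fun_prop))
      (Continuous.integrable_uniformSphere hk (by fun_prop)), ← integral_div]
    congr 1 with u
    rw [inner_add_left, inner_sub_left]; ring
  rw [h3, h1, h2, norm_add_sq_real, norm_sub_sq_real]; ring

/-! ### Smooth functions -/

/-- The quadratic bound on the first-order Taylor remainder of a function with `K`-Lipschitz
gradient. -/
theorem abs_sub_sub_inner_gradient_le {E : Type*} [NormedAddCommGroup E] [InnerProductSpace ℝ E]
    [CompleteSpace E] {F : E → ℝ} {K : ℝ} (hF : Differentiable ℝ F)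
    (hK : ∀ x y, ‖gradient F x - gradient F y‖ ≤ K * ‖x - y‖) (x v : E) :
    |F (x + v) - F x - inner ℝ (gradient F x) v| ≤ K / 2 * ‖v‖ ^ 2 := by
  -- the remainder along the segment, which has derivative at most `K s ‖v‖²`
  set r : ℝ → ℝ := fun s => F (x + s • v) - F x - s * inner ℝ (gradient F x) v with hr
  have hd : ∀ s, HasDerivAt r (inner ℝ (gradient F (x + s • v) - gradient F x) v) s := by
    intro s
    have h1 : HasDerivAt (fun s : ℝ => x + s • v) v s := by
      simpa using ((hasDerivAt_id s).smul_const v).const_add x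
    have h2 := ((hF (x + s • v)).hasGradientAt.hasFDerivAt).comp_hasDerivAt s h1
    have h3 := (h2.sub_const (F x)).sub ((hasDerivAt_id s).mul_const (inner ℝ (gradient F x) v))
    have h4 : HasDerivAt r _ s := h3
    exact h4.congr_deriv (by simp [inner_sub_left])
  have hb : ∀ s ∈ Set.Ico (0 : ℝ) 1,
      ‖inner ℝ (gradient F (x + s • v) - gradient F x) v‖ ≤ K * ‖v‖ ^ 2 * s := by
    intro s hs
    calc _ ≤ ‖gradient F (x + s • v) - gradient F x‖ * ‖v‖ := norm_inner_le_norm _ _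
      _ ≤ K * ‖x + s • v - x‖ * ‖v‖ := by gcongr; exact hK _ _
      _ = _ := by rw [add_sub_cancel_left, norm_smul, Real.norm_of_nonneg hs.1]; ring
  have hB : ∀ s : ℝ, HasDerivAt (fun s => K * ‖v‖ ^ 2 / 2 * s ^ 2) (K * ‖v‖ ^ 2 * s) s := by
    intro s
    have := ((hasDerivAt_id s).pow 2).const_mul (K * ‖v‖ ^ 2 / 2)
    exact this.congr_deriv (by simp; ring)
  have := image_norm_le_of_norm_deriv_right_le_deriv_boundary (a := 0) (b := 1) (f := r)
    (fun s _ => (hd s).continuousAt.continuousWithinAt)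
    (fun s _ => (hd s).hasDerivWithinAt) (by simp [hr]) hB hb
    (x := 1) (by simp)
  simp only [hr, one_smul, one_mul, Real.norm_eq_abs] at this
  linarith

theorem continuous_gradient_of_lipschitz {E : Type*} [NormedAddCommGroup E]
    [InnerProductSpace ℝ E] [CompleteSpace E] {F : E → ℝ} {K : ℝ}
    (hK : ∀ x y, ‖gradient F x - gradient F y‖ ≤ K * ‖x - y‖) : Continuous (gradient F) := by
  refine LipschitzWith.continuous (K := K.toNNReal) (LipschitzWith.of_dist_le_mul fun x y => ?_)
  rw [dist_eq_norm, dist_eq_norm]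
  exact (hK x y).trans (by gcongr; exact Real.le_coe_toNNReal K)

/-! ### The two-point estimator -/

/-- The two-point estimator of the gradient of `φ` at `x` along the direction `u`. -/
noncomputable def twoPoint {k : ℕ} (φ : Block k → ℝ) (μ : ℝ) (x u : Block k) : Block k :=
  ((k : ℝ) / μ * (φ (x + μ • u) - φ x)) • u

section TwoPoint

variable {k : ℕ} {φ : Block k → ℝ} {K μ : ℝ}

/-- The estimator differs from `k ⟨∇φ, u⟩ u`, which is unbiased, by at most `k K μ / 2`. -/
theorem norm_twoPoint_sub_le (hφ : Differentiable ℝ φ)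
    (hK : ∀ x y, ‖gradient φ x - gradient φ y‖ ≤ K * ‖x - y‖) (hμ : 0 < μ) (x u : Block k)
    (hu : ‖u‖ = 1) :
    ‖twoPoint φ μ x u - ((k : ℝ) * inner ℝ (gradient φ x) u) • u‖ ≤ k * K * μ / 2 := by
  have h := abs_sub_sub_inner_gradient_le hφ hK x (μ • u)
  rw [norm_smul, hu, mul_one, Real.norm_of_nonneg hμ.le, real_inner_smul_right] at h
  rw [twoPoint, ← sub_smul, norm_smul, hu, mul_one, Real.norm_eq_abs]
  have : (k : ℝ) / μ * (φ (x + μ • u) - φ x) - k * inner ℝ (gradient φ x) u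
      = k / μ * (φ (x + μ • u) - φ x - μ * inner ℝ (gradient φ x) u) := by
    field_simp
  rw [this, abs_mul, abs_of_nonneg (by positivity)]
  calc _ ≤ (k : ℝ) / μ * (K / 2 * μ ^ 2) := by gcongr
    _ = _ := by field_simp

theorem continuous_twoPoint (hφ : Differentiable ℝ φ) (x : Block k) :
    Continuous (twoPoint φ μ x) := by
  have := hφ.continuous
  unfold twoPoint
  fun_prop

theorem integral_inner_twoPoint_ge (hk : 1 ≤ k) (hφ : Differentiable ℝ φ)
    (hK : ∀ x y, ‖gradient φ x - gradient φ y‖ ≤ K * ‖x - y‖) (hμ : 0 < μ) (x g : Block k) :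
    inner ℝ g (gradient φ x) - k * K * μ / 2 * ‖g‖
      ≤ ∫ u, inner ℝ g (twoPoint φ μ x u) ∂(uniformSphere k) := by
  have := isProbabilityMeasure_uniformSphere hk
  have hk0 : (k : ℝ) ≠ 0 := by positivity
  have h1 : ∫ u, ((k : ℝ) * (inner ℝ (gradient φ x) u * inner ℝ g u) - k * K * μ / 2 * ‖g‖)
      ∂(uniformSphere k) = inner ℝ g (gradient φ x) - k * K * μ / 2 * ‖g‖ := by
    rw [integral_sub (Continuous.integrable_uniformSphere hk (by fun_prop)) (integrable_const _),
      integral_const_mul, integral_inner_mul_inner hk, integral_const, real_inner_comm]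
    simp
    field_simp
  rw [← h1]
  refine integral_mono_ae (Continuous.integrable_uniformSphere hk (by fun_prop))
    (Continuous.integrable_uniformSphere hk
      (continuous_const.inner (continuous_twoPoint hφ x))) ?_
  filter_upwards [ae_uniformSphere_norm k] with u hu
  have h2 := norm_twoPoint_sub_le hφ hK hμ x u hu
  set b := twoPoint φ μ x u - ((k : ℝ) * inner ℝ (gradient φ x) u) • u
  have h3 : twoPoint φ μ x u = ((k : ℝ) * inner ℝ (gradient φ x) u) • u + b := by simp [b]
  have h4 := neg_le_of_abs_le (abs_real_inner_le_norm g b)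
  have h5 : ‖g‖ * ‖b‖ ≤ ‖g‖ * (k * K * μ / 2) := by gcongr
  simp only [h3, inner_add_right, real_inner_smul_right]
  linarith

theorem integral_norm_twoPoint_sq_le (hk : 1 ≤ k) (hφ : Differentiable ℝ φ)
    (hK : ∀ x y, ‖gradient φ x - gradient φ y‖ ≤ K * ‖x - y‖) (hμ : 0 < μ) (x : Block k) :
    ∫ u, ‖twoPoint φ μ x u‖ ^ 2 ∂(uniformSphere k)
      ≤ 2 * k * ‖gradient φ x‖ ^ 2 + k ^ 2 * K ^ 2 * μ ^ 2 / 2 := by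
  have := isProbabilityMeasure_uniformSphere hk
  have hk0 : (k : ℝ) ≠ 0 := by positivity
  have h1 : ∫ u, (2 * (k : ℝ) ^ 2 * (inner ℝ (gradient φ x) u) ^ 2 + k ^ 2 * K ^ 2 * μ ^ 2 / 2)
      ∂(uniformSphere k) = 2 * k * ‖gradient φ x‖ ^ 2 + k ^ 2 * K ^ 2 * μ ^ 2 / 2 := by
    rw [integral_add (Continuous.integrable_uniformSphere hk (by fun_prop)) (integrable_const _),
      integral_const_mul, integral_inner_sq hk, integral_const]
    simp
    field_simp
  rw [← h1]
  refine integral_mono_ae (Continuous.integrable_uniformSphere hk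
    ((continuous_twoPoint hφ x).norm.pow 2))
    (Continuous.integrable_uniformSphere hk (by fun_prop)) ?_
  filter_upwards [ae_uniformSphere_norm k] with u hu
  have h2 := norm_twoPoint_sub_le hφ hK hμ x u hu
  set b := twoPoint φ μ x u - ((k : ℝ) * inner ℝ (gradient φ x) u) • u
  have h3 : twoPoint φ μ x u = ((k : ℝ) * inner ℝ (gradient φ x) u) • u + b := by simp [b]
  have h4 : ‖twoPoint φ μ x u‖ ≤ |(k : ℝ) * inner ℝ (gradient φ x) u| + k * K * μ / 2 := by
    rw [h3]
    refine (norm_add_le _ _).trans ?_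
    rw [norm_smul, hu, mul_one, Real.norm_eq_abs]
    gcongr
  have h5 : ‖twoPoint φ μ x u‖ ^ 2
      ≤ (|(k : ℝ) * inner ℝ (gradient φ x) u| + k * K * μ / 2) ^ 2 := by gcongr
  refine h5.trans ?_
  have h6 := sq_abs ((k : ℝ) * inner ℝ (gradient φ x) u)
  have h7 := sq_nonneg (|(k : ℝ) * inner ℝ (gradient φ x) u| - k * K * μ / 2)
  nlinarith [h6, h7]

end TwoPoint

/-! ### Blocks and partial gradients -/

section Blocks

variable {M : ℕ} {d : Fin (M + 1) → ℕ}

theorem inner_single_right (m : Fin (M + 1)) (w : Params d) (x : Block (d m)) :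
    inner ℝ w (PiLp.single 2 m x : Params d) = inner ℝ (w m) x := by
  rw [PiLp.inner_apply, Finset.sum_eq_single m]
  · simp
  · intro b _ hb
    simp [PiLp.single_eq_of_ne 2 hb]
  · simp

theorem setBlock_eq_add_single (w : Params d) (m : Fin (M + 1)) (v : Block (d m)) :
    setBlock w m v = w + PiLp.single 2 m (v - w m) := by
  ext1 k
  by_cases h : k = m
  · subst h; simp [setBlock]
  · simp [setBlock, h]

@[simp]
theorem setBlock_same (w : Params d) (m : Fin (M + 1)) (v : Block (d m)) :
    setBlock w m v m = v := by simp [setBlock]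

theorem setBlock_of_ne (w : Params d) {m k : Fin (M + 1)} (h : k ≠ m) (v : Block (d m)) :
    setBlock w m v k = w k := by simp [setBlock, h]

@[simp]
theorem setBlock_self (w : Params d) (m : Fin (M + 1)) : setBlock w m (w m) = w := by
  simp [setBlock]

@[simp]
theorem setBlock_setBlock (w : Params d) (m : Fin (M + 1)) (v v' : Block (d m)) :
    setBlock (setBlock w m v) m v' = setBlock w m v' := by
  simp [setBlock]

theorem norm_setBlock_sub (w : Params d) (m : Fin (M + 1)) (v v' : Block (d m)) :
    ‖setBlock w m v - setBlock w m v'‖ = ‖v - v'‖ := by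
  rw [setBlock_eq_add_single, setBlock_eq_add_single, add_sub_add_left_eq_sub,
    ← PiLp.single_sub, sub_sub_sub_cancel_right, PiLp.norm_single]

/-- The inclusion of a block, as a continuous linear map. -/
noncomputable def singleCLM (d : Fin (M + 1) → ℕ) (m : Fin (M + 1)) :
    Block (d m) →L[ℝ] Params d :=
  ((PiLp.continuousLinearEquiv 2 ℝ fun k => Block (d k)).symm :
      (∀ k, Block (d k)) →L[ℝ] Params d) ∘L
    ContinuousLinearMap.single ℝ (fun k => Block (d k)) m

theorem singleCLM_apply (m : Fin (M + 1)) (x : Block (d m)) :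
    singleCLM d m x = PiLp.single 2 m x := rfl

theorem continuous_setBlock (m : Fin (M + 1)) :
    Continuous fun p : Params d × Block (d m) => setBlock p.1 m p.2 := by
  simp_rw [setBlock_eq_add_single, ← singleCLM_apply]
  fun_prop

theorem hasGradientAt_setBlock {F : Params d → ℝ} (hF : Differentiable ℝ F) (w : Params d)
    (m : Fin (M + 1)) (v : Block (d m)) :
    HasGradientAt (fun v => F (setBlock w m v)) (gradient F (setBlock w m v) m) v := by
  have h1 : HasFDerivAt (fun v => setBlock w m v) (singleCLM d m) v := by
    simp_rw [setBlock_eq_add_single, ← singleCLM_apply]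
    exact ((singleCLM d m).hasFDerivAt.comp v ((hasFDerivAt_id v).sub_const _)).const_add w
  have h2 := (hF (setBlock w m v)).hasGradientAt.hasFDerivAt.comp v h1
  rw [hasGradientAt_iff_hasFDerivAt]
  refine h2.congr_fderiv ?_
  ext x
  exact inner_single_right m _ x

theorem partialGradient_eq {F : Params d → ℝ} (hF : Differentiable ℝ F) (m : Fin (M + 1))
    (w : Params d) : partialGradient F m w = gradient F w m := by
  have := (hasGradientAt_setBlock hF w m (w m)).gradient
  rwa [setBlock_self] at this

theorem gradient_comp_setBlock (F : Params d → ℝ) (w : Params d)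
    (m : Fin (M + 1)) (v : Block (d m)) :
    gradient (fun v => F (setBlock w m v)) v = partialGradient F m (setBlock w m v) := by
  simp [partialGradient]

theorem differentiable_comp_setBlock {F : Params d → ℝ} (hF : Differentiable ℝ F) (w : Params d)
    (m : Fin (M + 1)) : Differentiable ℝ fun v => F (setBlock w m v) :=
  fun v => (hasGradientAt_setBlock hF w m v).differentiableAt

theorem lipschitz_gradient_comp_setBlock {F : Params d → ℝ} {K : ℝ} {m : Fin (M + 1)}
    (hK : ∀ w w', ‖partialGradient F m w - partialGradient F m w'‖ ≤ K * ‖w - w'‖)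
    (w : Params d) (v v' : Block (d m)) :
    ‖gradient (fun v => F (setBlock w m v)) v - gradient (fun v => F (setBlock w m v)) v'‖
      ≤ K * ‖v - v'‖ := by
  rw [gradient_comp_setBlock, gradient_comp_setBlock]
  exact (hK _ _).trans_eq (by rw [norm_setBlock_sub])

theorem norm_gradient_sq {F : Params d → ℝ} (hF : Differentiable ℝ F) (w : Params d) :
    ‖gradient F w‖ ^ 2 = ‖partialGradient F 0 w‖ ^ 2
      + ∑ m : Fin M, ‖partialGradient F m.succ w‖ ^ 2 := by
  rw [PiLp.norm_sq_eq_of_L2, Fin.sum_univ_succ]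
  simp_rw [partialGradient_eq hF]

end Blocks

/-! ### One round from fixed parameters -/

/-- The estimate for the first and second order terms of one client: `g` is the true gradient,
`ξ` the sampling noise, `e` the error due to the delay, and `β` bounds the bias of the
estimator. The term linear in `ξ` is kept, since it has mean zero. -/
theorem client_quadratic_bound {E : Type*} [NormedAddCommGroup E] [InnerProductSpace ℝ E]
    (g ξ e : E) {κ β : ℝ} (h0 : 0 ≤ κ) (h1 : κ ≤ 1 / 4) :
    -inner ℝ g (g + ξ + e) + β * ‖g‖ + κ * ‖g + ξ + e‖ ^ 2
      ≤ -(1 / 4) * ‖g‖ ^ 2 + (2 * κ - 1) * inner ℝ g ξ + 2 * κ * ‖ξ‖ ^ 2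
        + 3 / 2 * ‖e‖ ^ 2 + β ^ 2 := by
  have a1 : ‖g + ξ + e‖ ^ 2 = ‖g‖ ^ 2 + ‖ξ‖ ^ 2 + ‖e‖ ^ 2 + 2 * inner ℝ g ξ + 2 * inner ℝ g e
      + 2 * inner ℝ ξ e := by
    rw [norm_add_sq_real, norm_add_sq_real, inner_add_left]; ring
  have a2 : inner ℝ g (g + ξ + e) = ‖g‖ ^ 2 + inner ℝ g ξ + inner ℝ g e := by
    rw [inner_add_right, inner_add_right, real_inner_self_eq_norm_sq]
  have a3 : 2 * inner ℝ ξ e ≤ ‖ξ‖ ^ 2 + ‖e‖ ^ 2 := by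
    have := norm_sub_sq_real ξ e
    nlinarith [sq_nonneg ‖ξ - e‖]
  have a4 : -inner ℝ g e ≤ ‖g‖ * ‖e‖ := by
    have := abs_real_inner_le_norm g e
    exact (neg_le_abs _).trans this
  rw [a1, a2]
  have a5 : κ * (2 * inner ℝ ξ e) ≤ κ * (‖ξ‖ ^ 2 + ‖e‖ ^ 2) := by gcongr
  have a6 : (1 - 2 * κ) * -inner ℝ g e ≤ (1 - 2 * κ) * (‖g‖ * ‖e‖) := by
    apply mul_le_mul_of_nonneg_left a4; linarith
  have a7 : (1 - 2 * κ) * (‖g‖ * ‖e‖) ≤ 1 * (‖g‖ * ‖e‖) := by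
    apply mul_le_mul_of_nonneg_right _ (by positivity); linarith
  have a8 : κ * ‖g‖ ^ 2 ≤ 1 / 4 * ‖g‖ ^ 2 := by gcongr
  have a9 : κ * ‖e‖ ^ 2 ≤ 1 / 4 * ‖e‖ ^ 2 := by gcongr
  nlinarith [sq_nonneg (‖g‖ / 2 - ‖e‖), sq_nonneg (‖g‖ / 2 - β)]

/-- The analogue of `client_quadratic_bound` for the server, whose step has no bias. -/
theorem server_quadratic_bound {E : Type*} [NormedAddCommGroup E] [InnerProductSpace ℝ E]
    (g ξ e : E) {κ : ℝ} (h0 : 0 ≤ κ) (h1 : κ ≤ 1 / 8) :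
    -inner ℝ g (g + ξ + e) + κ * ‖g + ξ + e‖ ^ 2
      ≤ -(1 / 4) * ‖g‖ ^ 2 + (2 * κ - 1) * inner ℝ g ξ + 2 * κ * ‖ξ‖ ^ 2
        + 3 / 4 * ‖e‖ ^ 2 := by
  have a1 : ‖g + ξ + e‖ ^ 2 = ‖g‖ ^ 2 + ‖ξ‖ ^ 2 + ‖e‖ ^ 2 + 2 * inner ℝ g ξ + 2 * inner ℝ g e
      + 2 * inner ℝ ξ e := by
    rw [norm_add_sq_real, norm_add_sq_real, inner_add_left]; ring
  have a2 : inner ℝ g (g + ξ + e) = ‖g‖ ^ 2 + inner ℝ g ξ + inner ℝ g e := by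
    rw [inner_add_right, inner_add_right, real_inner_self_eq_norm_sq]
  have a3 : 2 * inner ℝ ξ e ≤ ‖ξ‖ ^ 2 + ‖e‖ ^ 2 := by
    have := norm_sub_sq_real ξ e
    nlinarith [sq_nonneg ‖ξ - e‖]
  have a4 : -inner ℝ g e ≤ ‖g‖ * ‖e‖ := by
    have := abs_real_inner_le_norm g e
    exact (neg_le_abs _).trans this
  rw [a1, a2]
  have a5 : κ * (2 * inner ℝ ξ e) ≤ κ * (‖ξ‖ ^ 2 + ‖e‖ ^ 2) := by gcongr
  have a6 : (1 - 2 * κ) * -inner ℝ g e ≤ (1 - 2 * κ) * (‖g‖ * ‖e‖) := by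
    apply mul_le_mul_of_nonneg_left a4; linarith
  have a7 : (1 - 2 * κ) * (‖g‖ * ‖e‖) ≤ 1 * (‖g‖ * ‖e‖) := by
    apply mul_le_mul_of_nonneg_right _ (by positivity); linarith
  have a8 : κ * ‖g‖ ^ 2 ≤ 1 / 8 * ‖g‖ ^ 2 := by gcongr
  have a9 : κ * ‖e‖ ^ 2 ≤ 1 / 8 * ‖e‖ ^ 2 := by gcongr
  nlinarith [sq_nonneg (‖g‖ - ‖e‖)]

namespace VFLProblem

variable {M n : ℕ} {d : Fin (M + 1) → ℕ}

/-- The assumptions on the problem and on the sampling, in terms of the extremal constants only: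
one Lipschitz constant `K`, one variance bound `s ^ 2`, one gradient bound `g`, a bound `D` on the
dimensions of the clients, and a lower bound `π` on the probabilities `p`. -/
structure UniformBounds (V : VFLProblem.{u} M n d) (p : Fin M → ℝ) (q : Fin n → ℝ)
    (K s g π : ℝ) (D : ℕ) : Prop where
  K_pos : 0 < K
  one_le_dim : ∀ m : Fin M, 1 ≤ d m.succ
  dim_le : ∀ m : Fin M, d m.succ ≤ D
  π_pos : 0 < π
  π_le : ∀ m, π ≤ p m
  sum_p : ∑ m, p m = 1
  q_nonneg : ∀ i, 0 ≤ q i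
  sum_q : ∑ i, q i = 1
  bddBelow : BddBelow (Set.range V.objective)
  differentiable : ∀ i, Differentiable ℝ (V.sampleLoss i)
  lipschitz : ∀ i m w w',
    ‖partialGradient (V.sampleLoss i) m w - partialGradient (V.sampleLoss i) m w'‖ ≤ K * ‖w - w'‖
  lipschitz_objective : ∀ w w',
    ‖gradient V.objective w - gradient V.objective w'‖ ≤ K * ‖w - w'‖
  unbiased : V.UnbiasedGradient q
  variance : ∀ m w, ∑ i, q i *
    ‖partialGradient (V.sampleLoss i) m w - partialGradient V.objective m w‖ ^ 2 ≤ s ^ 2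
  client_gradient : ∀ i (m : Fin M) w, ‖partialGradient (V.sampleLoss i) m.succ w‖ ≤ g

/-- The parameters after a round which starts at `W`, where the gradients are computed at `W'`,
the active client is `a`, the sample is `i` and the direction is `x`. -/
noncomputable def hybridStep (V : VFLProblem.{u} M n d) (η μ : ℝ) (W W' : Params d) (a : Fin M)
    (i : Fin n) (x : Block (d a.succ)) : Params d :=
  setBlock (setBlock W 0 (W 0 - η • partialGradient (V.sampleLoss i) 0 W')) a.succ
    (W a.succ - η • V.zoGradient i a μ W' x)

theorem zoGradient_eq_twoPoint (V : VFLProblem.{u} M n d) (i : Fin n) (a : Fin M) (μ : ℝ)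
    (w : Params d) (x : Block (d a.succ)) :
    V.zoGradient i a μ w x
      = twoPoint (fun v => V.sampleLoss i (setBlock w a.succ v)) μ (w a.succ) x := by
  simp [zoGradient, twoPoint]

theorem hybridStep_eq (V : VFLProblem.{u} M n d) (η μ : ℝ) (W W' : Params d) (a : Fin M)
    (i : Fin n) (x : Block (d a.succ)) :
    V.hybridStep η μ W W' a i x = W
      + (PiLp.single 2 0 (-η • partialGradient (V.sampleLoss i) 0 W')
        + PiLp.single 2 a.succ (-η • V.zoGradient i a μ W' x)) := by
  rw [hybridStep, setBlock_eq_add_single, setBlock_of_ne _ (Fin.succ_ne_zero a),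
    setBlock_eq_add_single]
  simp [sub_eq_add_neg, add_assoc]

theorem differentiable_objective (V : VFLProblem.{u} M n d)
    (h : ∀ i, Differentiable ℝ (V.sampleLoss i)) : Differentiable ℝ V.objective := by
  unfold objective
  fun_prop

namespace UniformBounds

variable {V : VFLProblem.{u} M n d} {p : Fin M → ℝ} {q : Fin n → ℝ} {K s g π η μ : ℝ} {D : ℕ}

theorem objective_hybridStep_le (hV : V.UniformBounds p q K s g π D) (W W' : Params d)
    (a : Fin M) (i : Fin n) (x : Block (d a.succ)) :
    V.objective (V.hybridStep η μ W W' a i x) ≤ V.objective W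
      - η * inner ℝ (partialGradient V.objective 0 W) (partialGradient (V.sampleLoss i) 0 W')
      - η * inner ℝ (partialGradient V.objective a.succ W) (V.zoGradient i a μ W' x)
      + K / 2 * η ^ 2 * (‖partialGradient (V.sampleLoss i) 0 W'‖ ^ 2
        + ‖V.zoGradient i a μ W' x‖ ^ 2) := by
  have hd := V.differentiable_objective hV.differentiable
  set v : Params d := PiLp.single 2 0 (-η • partialGradient (V.sampleLoss i) 0 W')
        + PiLp.single 2 a.succ (-η • V.zoGradient i a μ W' x) with hv
  have h := (abs_le.mp (abs_sub_sub_inner_gradient_le hd hV.lipschitz_objective W v)).2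
  have h1 : inner ℝ (gradient V.objective W) v
      = -η * inner ℝ (partialGradient V.objective 0 W) (partialGradient (V.sampleLoss i) 0 W')
      - η * inner ℝ (partialGradient V.objective a.succ W) (V.zoGradient i a μ W' x) := by
    rw [hv, inner_add_right, inner_single_right, inner_single_right, inner_smul_right,
      inner_smul_right, partialGradient_eq hd, partialGradient_eq hd]
    ring
  have h2 : ‖v‖ ^ 2 = η ^ 2 * (‖partialGradient (V.sampleLoss i) 0 W'‖ ^ 2
        + ‖V.zoGradient i a μ W' x‖ ^ 2) := by
    rw [hv, norm_add_sq_real, inner_single_right, PiLp.norm_single, PiLp.norm_single,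
      PiLp.single_eq_of_ne 2 (Fin.succ_ne_zero a), inner_zero_left, norm_smul, norm_smul,
      mul_pow, mul_pow, Real.norm_eq_abs, sq_abs]
    ring
  rw [hybridStep_eq, ← hv]
  rw [h1, h2] at h
  linarith

theorem continuous_zoGradient (hV : V.UniformBounds p q K s g π D) (a : Fin M) (i : Fin n) :
    Continuous fun z : Params d × Block (d a.succ) => V.zoGradient i a μ z.1 z.2 := by
  have h1 := (hV.differentiable i).continuous
  have h2 := continuous_setBlock (d := d) a.succ
  have h3 : Continuous fun z : Params d × Block (d a.succ) =>
      setBlock z.1 a.succ (z.1 a.succ + μ • z.2) :=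
    h2.comp (f := fun z : Params d × Block (d a.succ) => (z.1, z.1 a.succ + μ • z.2))
      (by fun_prop)
  unfold zoGradient
  fun_prop

theorem continuous_partialGradient (hV : V.UniformBounds p q K s g π D) (i : Fin n)
    (m : Fin (M + 1)) : Continuous (partialGradient (V.sampleLoss i) m) := by
  refine LipschitzWith.continuous (K := K.toNNReal) (LipschitzWith.of_dist_le_mul fun x y => ?_)
  rw [dist_eq_norm, dist_eq_norm]
  exact (hV.lipschitz i m x y).trans (by gcongr; exact Real.le_coe_toNNReal K)

theorem continuous_hybridStep (hV : V.UniformBounds p q K s g π D) (a : Fin M) (i : Fin n) :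
    Continuous fun z : (Params d × Params d) × Block (d a.succ) =>
      V.hybridStep η μ z.1.1 z.1.2 a i z.2 := by
  have h1 := hV.continuous_partialGradient i 0
  have h2 : Continuous fun z : (Params d × Params d) × Block (d a.succ) =>
      V.zoGradient i a μ z.1.2 z.2 :=
    (hV.continuous_zoGradient a i).comp
      (f := fun z : (Params d × Params d) × Block (d a.succ) => (z.1.2, z.2)) (by fun_prop)
  simp_rw [hybridStep_eq, ← singleCLM_apply]
  fun_prop

theorem integral_norm_zoGradient_sq_le (hV : V.UniformBounds p q K s g π D) (hμ : 0 < μ)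
    (a : Fin M) (i : Fin n) (W : Params d) :
    ∫ x, ‖V.zoGradient i a μ W x‖ ^ 2 ∂(uniformSphere (d a.succ))
      ≤ 2 * D * ‖partialGradient (V.sampleLoss i) a.succ W‖ ^ 2 + D ^ 2 * K ^ 2 * μ ^ 2 / 2 := by
  have h := integral_norm_twoPoint_sq_le (hV.one_le_dim a)
    (differentiable_comp_setBlock (hV.differentiable i) W a.succ)
    (lipschitz_gradient_comp_setBlock (hV.lipschitz i a.succ) W) hμ (W a.succ)
  rw [gradient_comp_setBlock, setBlock_self] at h
  simp_rw [zoGradient_eq_twoPoint]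
  have hD : (d a.succ : ℝ) ≤ D := by exact_mod_cast hV.dim_le a
  refine h.trans ?_
  gcongr

/-- The expected objective after a round with given client and sample. -/
theorem integral_objective_hybridStep_le (hV : V.UniformBounds p q K s g π D) (hη : 0 < η)
    (hμ : 0 < μ) (W W' : Params d) (a : Fin M) (i : Fin n) :
    ∫ x, V.objective (V.hybridStep η μ W W' a i x) ∂(uniformSphere (d a.succ))
      ≤ V.objective W + η *
        ((-inner ℝ (partialGradient V.objective 0 W) (partialGradient (V.sampleLoss i) 0 W')
          + K * η / 2 * ‖partialGradient (V.sampleLoss i) 0 W'‖ ^ 2)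
        + (-inner ℝ (partialGradient V.objective a.succ W)
            (partialGradient (V.sampleLoss i) a.succ W')
          + D * K * μ / 2 * ‖partialGradient V.objective a.succ W‖
          + K * η * D * ‖partialGradient (V.sampleLoss i) a.succ W'‖ ^ 2)
        + η * K ^ 3 * D ^ 2 * μ ^ 2 / 4) := by
  have hk := hV.one_le_dim a
  have := isProbabilityMeasure_uniformSphere hk
  have hD : (d a.succ : ℝ) ≤ D := by exact_mod_cast hV.dim_le a
  have hK := hV.K_pos
  have hc1 : Continuous fun x => V.zoGradient i a μ W' x :=
    (hV.continuous_zoGradient a i).comp (f := fun x => (W', x)) (by fun_prop)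
  have hc2 : Continuous fun x => V.objective (V.hybridStep η μ W W' a i x) :=
    (V.differentiable_objective hV.differentiable).continuous.comp
      ((hV.continuous_hybridStep a i).comp (f := fun x => ((W, W'), x)) (by fun_prop))
  set g0 := partialGradient V.objective 0 W
  set ga := partialGradient V.objective a.succ W
  set X0 := partialGradient (V.sampleLoss i) 0 W'
  have i1 := Continuous.integrable_uniformSphere hk
    (h := fun x => inner ℝ ga (V.zoGradient i a μ W' x)) (by fun_prop)
  have i2 := Continuous.integrable_uniformSphere hk
    (h := fun x => ‖V.zoGradient i a μ W' x‖ ^ 2) (by fun_prop)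
  have h1 : ∫ x, V.objective (V.hybridStep η μ W W' a i x) ∂(uniformSphere (d a.succ))
      ≤ ∫ x, ((V.objective W - η * inner ℝ g0 X0 + K / 2 * η ^ 2 * ‖X0‖ ^ 2)
        - η * inner ℝ ga (V.zoGradient i a μ W' x)
        + K / 2 * η ^ 2 * ‖V.zoGradient i a μ W' x‖ ^ 2) ∂(uniformSphere (d a.succ)) := by
    refine integral_mono (Continuous.integrable_uniformSphere hk hc2)
      (Continuous.integrable_uniformSphere hk (by fun_prop)) fun x => ?_
    have := hV.objective_hybridStep_le (η := η) (μ := μ) W W' a i x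
    simp only
    linarith
  have i3 : Integrable (fun x => (V.objective W - η * inner ℝ g0 X0 + K / 2 * η ^ 2 * ‖X0‖ ^ 2)
      - η * inner ℝ ga (V.zoGradient i a μ W' x)) (uniformSphere (d a.succ)) :=
    (integrable_const _).sub (i1.const_mul η)
  rw [integral_add i3 (i2.const_mul _), integral_sub (integrable_const _) (i1.const_mul η), integral_const_mul, integral_const_mul,
    integral_const, probReal_univ, one_smul] at h1
  have h2 := hV.integral_norm_zoGradient_sq_le hμ a i W'
  have h3 := integral_inner_twoPoint_ge (hV.one_le_dim a)
    (differentiable_comp_setBlock (hV.differentiable i) W' a.succ)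
    (lipschitz_gradient_comp_setBlock (hV.lipschitz i a.succ) W') hμ (W' a.succ) ga
  rw [gradient_comp_setBlock, setBlock_self] at h3
  simp_rw [← zoGradient_eq_twoPoint] at h3
  have h4 : (d a.succ : ℝ) * K * μ / 2 * ‖ga‖ ≤ D * K * μ / 2 * ‖ga‖ := by gcongr
  have h5 := mul_le_mul_of_nonneg_left h2 (show 0 ≤ K / 2 * η ^ 2 by positivity)
  have h6 := mul_le_mul_of_nonneg_left (h3.trans' (sub_le_sub_left h4 _)) hη.le
  refine h1.trans ?_
  nlinarith [h5, h6]

theorem sum_mul_inner_noise (hV : V.UniformBounds p q K s g π D) (m : Fin (M + 1))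
    (W : Params d) (y : Block (d m)) :
    ∑ i, q i * inner ℝ y
      (partialGradient (V.sampleLoss i) m W - partialGradient V.objective m W) = 0 := by
  simp_rw [← real_inner_smul_right, ← inner_sum, smul_sub, Finset.sum_sub_distrib,
    hV.unbiased m W, ← Finset.sum_smul, hV.sum_q, one_smul, sub_self, inner_zero_right]

/-- The expected decrease of the objective in one round, where the parameters `W' a i` used by
the round are within distance `√δ` of the current ones. -/
theorem sum_integral_objective_hybridStep_le (hV : V.UniformBounds p q K s g π D) (hη : 0 < η)
    (hμ : 0 < μ) (hηD : K * η * D ≤ 1 / 4) (W : Params d) (W' : Fin M → Fin n → Params d) {δ : ℝ}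
    (hδ : ∀ a i, ‖W' a i - W‖ ^ 2 ≤ δ) :
    ∑ a, ∑ i, p a * q i *
        ∫ x, V.objective (V.hybridStep η μ W (W' a i) a i x) ∂(uniformSphere (d a.succ))
      ≤ V.objective W - η * π / 4 * ‖gradient V.objective W‖ ^ 2
        + η * (9 / 4 * K ^ 2 * δ + D ^ 2 * K ^ 2 * μ ^ 2 / 4 + η * K ^ 3 * D ^ 2 * μ ^ 2 / 4
          + K * η * s ^ 2 + 2 * K * η * D * s ^ 2) := by
  have hK := hV.K_pos
  have hp : ∀ a, 0 ≤ p a := fun a => hV.π_pos.le.trans (hV.π_le a)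
  set G := fun m => partialGradient V.objective m W with hG
  set ξ := fun i m => partialGradient (V.sampleLoss i) m W - G m with hξ
  have hD0 : ∀ a : Fin M, (1 : ℝ) ≤ D := fun a => by
    exact_mod_cast (hV.one_le_dim a).trans (hV.dim_le a)
  -- the error due to the delay
  have he : ∀ a i m, ‖partialGradient (V.sampleLoss i) m (W' a i)
      - partialGradient (V.sampleLoss i) m W‖ ^ 2 ≤ K ^ 2 * δ := by
    intro a i m
    calc _ ≤ (K * ‖W' a i - W‖) ^ 2 := by gcongr; exact hV.lipschitz i m _ _
      _ = K ^ 2 * ‖W' a i - W‖ ^ 2 := by ring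
      _ ≤ _ := by gcongr; exact hδ a i
  set R := 9 / 4 * K ^ 2 * δ + D ^ 2 * K ^ 2 * μ ^ 2 / 4 + η * K ^ 3 * D ^ 2 * μ ^ 2 / 4 with hR
  have hai : ∀ a i,
      ∫ x, V.objective (V.hybridStep η μ W (W' a i) a i x) ∂(uniformSphere (d a.succ))
      ≤ (V.objective W + η * (-(1 / 4) * ‖G 0‖ ^ 2 - 1 / 4 * ‖G a.succ‖ ^ 2 + R))
        + η * (K * η - 1) * inner ℝ (G 0) (ξ i 0)
        + η * (2 * (K * η * D) - 1) * inner ℝ (G a.succ) (ξ i a.succ)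
        + η * (K * η) * ‖ξ i 0‖ ^ 2 + η * (2 * (K * η * D)) * ‖ξ i a.succ‖ ^ 2 := by
    intro a i
    refine (hV.integral_objective_hybridStep_le hη hμ W (W' a i) a i).trans ?_
    have hκ : K * η / 2 ≤ 1 / 8 := by nlinarith [hD0 a, mul_pos hK hη]
    have b0 := server_quadratic_bound (G 0) (ξ i 0)
      (partialGradient (V.sampleLoss i) 0 (W' a i) - partialGradient (V.sampleLoss i) 0 W)
      (show 0 ≤ K * η / 2 by positivity) hκ
    have ba := client_quadratic_bound (G a.succ) (ξ i a.succ)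
      (partialGradient (V.sampleLoss i) a.succ (W' a i)
        - partialGradient (V.sampleLoss i) a.succ W) (β := D * K * μ / 2)
      (show 0 ≤ K * η * D by positivity) hηD
    simp only [hξ, add_sub_cancel] at b0 ba
    have e0 := he a i 0
    have ea := he a i a.succ
    have hb : ((D : ℝ) * K * μ / 2) ^ 2 = D ^ 2 * K ^ 2 * μ ^ 2 / 4 := by ring
    have := mul_le_mul_of_nonneg_left
      (add_le_add b0 ba) hη.le
    have e0' := mul_le_mul_of_nonneg_left e0 hη.le
    have ea' := mul_le_mul_of_nonneg_left ea hη.le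
    simp only [hξ, hG, hR]
    nlinarith [this, e0', ea', hb]
  have hvar : ∀ m, ∑ i, q i * ‖ξ i m‖ ^ 2 ≤ s ^ 2 := fun m => hV.variance m W
  have hnoise : ∀ m, ∑ i, q i * inner ℝ (G m) (ξ i m) = 0 :=
    fun m => hV.sum_mul_inner_noise m W (G m)
  have ha : ∀ a, ∑ i, q i *
      ∫ x, V.objective (V.hybridStep η μ W (W' a i) a i x) ∂(uniformSphere (d a.succ))
      ≤ V.objective W + η * (-(1 / 4) * ‖G 0‖ ^ 2 - 1 / 4 * ‖G a.succ‖ ^ 2 + R)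
        + η * (K * η) * s ^ 2 + η * (2 * (K * η * D)) * s ^ 2 := by
    intro a
    calc _ ≤ ∑ i, q i * _ := Finset.sum_le_sum fun i _ =>
          mul_le_mul_of_nonneg_left (hai a i) (hV.q_nonneg i)
      _ = (∑ i, q i) * (V.objective W
            + η * (-(1 / 4) * ‖G 0‖ ^ 2 - 1 / 4 * ‖G a.succ‖ ^ 2 + R))
          + η * (K * η - 1) * ∑ i, q i * inner ℝ (G 0) (ξ i 0)
          + η * (2 * (K * η * D) - 1) * ∑ i, q i * inner ℝ (G a.succ) (ξ i a.succ)
          + η * (K * η) * ∑ i, q i * ‖ξ i 0‖ ^ 2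
          + η * (2 * (K * η * D)) * ∑ i, q i * ‖ξ i a.succ‖ ^ 2 := by
        rw [Finset.sum_mul]
        simp only [Finset.mul_sum, ← Finset.sum_add_distrib]
        exact Finset.sum_congr rfl fun i _ => by ring
      _ ≤ _ := by
        rw [hV.sum_q, hnoise, hnoise, one_mul, mul_zero, mul_zero, add_zero, add_zero]
        gcongr
        · exact hvar 0
        · exact hvar a.succ
  calc _ = ∑ a, p a * ∑ i, q i *
        ∫ x, V.objective (V.hybridStep η μ W (W' a i) a i x) ∂(uniformSphere (d a.succ)) := by
        simp only [Finset.mul_sum, mul_assoc]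
    _ ≤ ∑ a, p a * _ := Finset.sum_le_sum fun a _ => mul_le_mul_of_nonneg_left (ha a) (hp a)
    _ = (∑ a, p a) * (V.objective W + η * (-(1 / 4) * ‖G 0‖ ^ 2 + R)
          + η * (K * η) * s ^ 2 + η * (2 * (K * η * D)) * s ^ 2)
        - η / 4 * ∑ a, p a * ‖G (Fin.succ a)‖ ^ 2 := by
        rw [Finset.sum_mul, Finset.mul_sum, ← Finset.sum_sub_distrib]
        exact Finset.sum_congr rfl fun a _ => by ring
    _ ≤ _ := by
        have h1 : π * ∑ a : Fin M, ‖G a.succ‖ ^ 2 ≤ ∑ a, p a * ‖G (Fin.succ a)‖ ^ 2 := by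
          rw [Finset.mul_sum]
          exact Finset.sum_le_sum fun a _ => by gcongr; exact hV.π_le a
        have hπ : π ≤ 1 := by
          rcases Nat.eq_zero_or_pos M with rfl | hM
          · simpa using hV.sum_p
          · rw [← hV.sum_p]
            exact (hV.π_le ⟨0, hM⟩).trans
              (Finset.single_le_sum (fun a _ => hp a) (Finset.mem_univ _))
        have h2 : π * ‖G 0‖ ^ 2 ≤ 1 * ‖G 0‖ ^ 2 := by gcongr
        rw [hV.sum_p, norm_gradient_sq (V.differentiable_objective hV.differentiable)]
        have h3 := mul_le_mul_of_nonneg_left (add_le_add h1 h2) hη.le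
        simp only [hG] at h3 ⊢
        linarith

end UniformBounds

end VFLProblem

/-! ### The random choices of a round -/

/-- An event in the first of two independent variables factors out of the integral of a function
of the second. -/
theorem setLIntegral_of_indepFun {Ω α β : Type*} {mΩ : MeasurableSpace Ω} [MeasurableSpace α]
    [MeasurableSpace β] {P : Measure Ω} {X : Ω → α} {Z : Ω → β} (hX : Measurable X)
    (hZ : Measurable Z) (hXZ : IndepFun X Z P) {S : Set α} (hS : MeasurableSet S)
    {h : β → ENNReal} (hh : Measurable h) :
    ∫⁻ ω in X ⁻¹' S, h (Z ω) ∂P = P (X ⁻¹' S) * ∫⁻ z, h z ∂(P.map Z) := by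
  rw [lintegral_map hh hZ, ← lintegral_indicator (hX hS)]
  have h1 := lintegral_mul_eq_lintegral_mul_lintegral_of_indepFun
    (f := fun ω => S.indicator (fun _ => (1 : ENNReal)) (X ω)) (g := fun ω => h (Z ω))
    ((measurable_const.indicator hS).comp hX) (hh.comp hZ)
    (hXZ.comp (measurable_const.indicator hS) hh)
  have h2 : ∫⁻ ω, S.indicator (fun _ => (1 : ENNReal)) (X ω) ∂P = P (X ⁻¹' S) := by
    rw [← lintegral_indicator_one (hX hS)]
    rfl
  rw [h2] at h1
  rw [← h1]
  refine lintegral_congr fun ω => ?_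
  by_cases hω : X ω ∈ S
  · simp [hω]
  · simp [hω]

theorem measurable_of_countable_choice {Ω α γ : Type*} {m : MeasurableSpace Ω}
    [MeasurableSpace α] [MeasurableSpace γ] [Countable α] [MeasurableSingletonClass α]
    {c : Ω → α} (hc : Measurable c) {f : α → Ω → γ} (hf : ∀ x, Measurable (f x)) :
    Measurable fun ω => f (c ω) ω :=
  (measurable_from_prod_countable_right (f := fun z : α × Ω => f z.1 z.2) hf).comp
    (hc.prodMk measurable_id)

theorem measurable_delayedParams {M : ℕ} {d : Fin (M + 1) → ℕ} {Ω : Type*} {m : MeasurableSpace Ω}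
    {w : ℕ → Ω → Params d} {t : ℕ} (hw : ∀ s ≤ t, Measurable (w s)) {δ : Ω → Fin M → ℕ}
    (hδ : ∀ k, Measurable fun ω => δ ω k) :
    Measurable fun ω => delayedParams (fun s => w s ω) t (δ ω) := by
  have hcoord : ∀ s ≤ t, ∀ k, Measurable fun ω => w s ω k := fun s hs k =>
    (show Continuous fun x : Params d => x k by fun_prop).measurable.comp (hw s hs)
  refine (WithLp.measurable_toLp 2 _).comp (measurable_pi_lambda _ fun k => ?_)
  refine Fin.cases ?_ (fun k => ?_) k
  · exact hcoord t le_rfl 0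
  · exact measurable_of_countable_choice (hδ k) (f := fun j ω => w (t - j) ω k.succ)
      fun j => hcoord (t - j) (Nat.sub_le _ _) k.succ

/-- The delayed parameters are close to the current ones, if the clients moved little in the
last `τ` rounds. -/
theorem norm_delayedParams_sub_sq_le {M : ℕ} {d : Fin (M + 1) → ℕ} (w : ℕ → Params d) (t : ℕ)
    {δ : Fin M → ℕ} {τ : ℕ} (hδ : ∀ m, δ m ≤ τ) :
    ‖delayedParams w t δ - w t‖ ^ 2 ≤ τ * ∑ s ∈ Finset.Ico (t - τ) t,
      ∑ m : Fin M, ‖w (s + 1) m.succ - w s m.succ‖ ^ 2 := by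
  rw [PiLp.norm_sq_eq_of_L2, Fin.sum_univ_succ, Finset.sum_comm, Finset.mul_sum]
  have h0 : (delayedParams w t δ - w t) 0 = 0 := by simp [delayedParams]
  rw [h0, norm_zero, zero_pow two_ne_zero, zero_add]
  refine Finset.sum_le_sum fun m _ => ?_
  have h1 : (delayedParams w t δ - w t) m.succ
      = -∑ s ∈ Finset.Ico (t - δ m) t, (w (s + 1) m.succ - w s m.succ) := by
    rw [Finset.sum_Ico_sub (fun s => w s m.succ) (Nat.sub_le _ _)]
    simp [delayedParams]
  rw [h1, norm_neg]
  calc _ ≤ (∑ s ∈ Finset.Ico (t - δ m) t, ‖w (s + 1) m.succ - w s m.succ‖) ^ 2 := by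
        gcongr; exact norm_sum_le _ _
    _ ≤ _ * _ := sq_sum_le_card_mul_sum_sq
    _ ≤ _ := by
        gcongr
        · rw [Nat.card_Ico]
          have := hδ m
          omega
        · exact hδ m

/-- The extended nonnegative form of `sum_integral_objective_hybridStep_le`: the expected gap after
a round, which needs no integrability over the past. -/
theorem VFLProblem.UniformBounds.sum_lintegral_gap_add_le {M n : ℕ} {d : Fin (M + 1) → ℕ}
    {V : VFLProblem.{u} M n d} {p : Fin M → ℝ} {q : Fin n → ℝ} {K s g π η μ : ℝ} {D : ℕ}
    (hV : V.UniformBounds p q K s g π D) (hη : 0 < η)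
    (hμ : 0 < μ) (hηD : K * η * D ≤ 1 / 4) (W : Params d) (W' : Fin M → Fin n → Params d) {δ : ℝ}
    (hδ0 : 0 ≤ δ) (hδ : ∀ a i, ‖W' a i - W‖ ^ 2 ≤ δ) :
    (∑ a, ∑ i, ENNReal.ofReal (p a * q i) *
        ∫⁻ x, ENNReal.ofReal (V.objective (V.hybridStep η μ W (W' a i) a i x) - V.optimalValue)
          ∂(uniformSphere (d a.succ)))
      + ENNReal.ofReal (η * π / 4 * ‖gradient V.objective W‖ ^ 2)
      ≤ ENNReal.ofReal (V.objective W - V.optimalValue)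
        + (ENNReal.ofReal (9 / 4 * η * K ^ 2) * ENNReal.ofReal δ
          + ENNReal.ofReal (η * (D ^ 2 * K ^ 2 * μ ^ 2 / 4 + η * K ^ 3 * D ^ 2 * μ ^ 2 / 4
          + K * η * s ^ 2 + 2 * K * η * D * s ^ 2))) := by
  have hK := hV.K_pos
  have hp : ∀ a, 0 ≤ p a := fun a => hV.π_pos.le.trans (hV.π_le a)
  have hpq : ∀ a i, 0 ≤ p a * q i := fun a i => mul_nonneg (hp a) (hV.q_nonneg i)
  have hopt : ∀ W, V.optimalValue ≤ V.objective W := fun W => ciInf_le hV.bddBelow W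
  have hobj : Continuous V.objective := (V.differentiable_objective hV.differentiable).continuous
  set c := η * (D ^ 2 * K ^ 2 * μ ^ 2 / 4 + η * K ^ 3 * D ^ 2 * μ ^ 2 / 4
          + K * η * s ^ 2 + 2 * K * η * D * s ^ 2) with hc
  have hc0 : 0 ≤ c := by positivity
  set J := fun a i => ∫ x, V.objective (V.hybridStep η μ W (W' a i) a i x)
    ∂(uniformSphere (d a.succ)) with hJ
  have hint : ∀ a i, 0 ≤ J a i - V.optimalValue ∧
      ∫⁻ x, ENNReal.ofReal (V.objective (V.hybridStep η μ W (W' a i) a i x) - V.optimalValue)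
        ∂(uniformSphere (d a.succ)) = ENNReal.ofReal (J a i - V.optimalValue) := fun a i => by
    have hk := hV.one_le_dim a
    have := isProbabilityMeasure_uniformSphere hk
    have hi : Continuous fun x => V.objective (V.hybridStep η μ W (W' a i) a i x) :=
      hobj.comp ((hV.continuous_hybridStep a i).comp (f := fun x => ((W, W' a i), x))
        (by fun_prop))
    have h1 : ∫ x, (V.objective (V.hybridStep η μ W (W' a i) a i x) - V.optimalValue)
        ∂(uniformSphere (d a.succ)) = J a i - V.optimalValue := by
      rw [integral_sub (Continuous.integrable_uniformSphere hk hi) (integrable_const _)]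
      simp [hJ]
    constructor
    · rw [← h1]
      exact integral_nonneg fun x => sub_nonneg.mpr (hopt _)
    · rw [← h1]
      exact (ofReal_integral_eq_lintegral_ofReal
        (Continuous.integrable_uniformSphere hk (hi.sub continuous_const))
        (Filter.Eventually.of_forall fun x => sub_nonneg.mpr (hopt _))).symm
  set X := ∑ a, ∑ i, p a * q i * (J a i - V.optimalValue) with hX
  have hX0 : 0 ≤ X := Finset.sum_nonneg fun a _ => Finset.sum_nonneg fun i _ =>
    mul_nonneg (hpq a i) (hint a i).1
  have hAX : ∑ a, ∑ i, ENNReal.ofReal (p a * q i) *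
      ∫⁻ x, ENNReal.ofReal (V.objective (V.hybridStep η μ W (W' a i) a i x) - V.optimalValue)
        ∂(uniformSphere (d a.succ)) = ENNReal.ofReal X := by
    rw [hX, ENNReal.ofReal_sum_of_nonneg fun a _ => Finset.sum_nonneg fun i _ =>
      mul_nonneg (hpq a i) (hint a i).1]
    refine Finset.sum_congr rfl fun a _ => ?_
    rw [ENNReal.ofReal_sum_of_nonneg fun i _ => mul_nonneg (hpq a i) (hint a i).1]
    refine Finset.sum_congr rfl fun i _ => ?_
    rw [ENNReal.ofReal_mul (hpq a i), (hint a i).2]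
  have hone : ∑ a, ∑ i, p a * q i = 1 := by
    simp_rw [← Finset.mul_sum, hV.sum_q, mul_one, hV.sum_p]
  have hXle : X + η * π / 4 * ‖gradient V.objective W‖ ^ 2
      ≤ (V.objective W - V.optimalValue) + (9 / 4 * η * K ^ 2 * δ + c) := by
    have h1 := hV.sum_integral_objective_hybridStep_le hη hμ hηD W W' hδ
    have h2 : X = ∑ a, ∑ i, p a * q i * J a i - V.optimalValue := by
      rw [hX]
      simp_rw [mul_sub, Finset.sum_sub_distrib, ← Finset.sum_mul]
      rw [hone, one_mul]
    rw [h2, hc]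
    simp only [hJ]
    linarith
  rw [hAX, ← ENNReal.ofReal_add hX0 (by have := hV.π_pos; positivity),
    ← ENNReal.ofReal_mul (by positivity),
    ← ENNReal.ofReal_add (by positivity) hc0,
    ← ENNReal.ofReal_add (sub_nonneg.mpr (hopt _)) (by positivity)]
  exact ENNReal.ofReal_le_ofReal hXle

/-- The parameters that the server sees at round `t` if client `a` is active with sample `i`. -/
abbrev staleParams {M n : ℕ} {d : Fin (M + 1) → ℕ} {Ω : Type*} (w : ℕ → Ω → Params d)
    (delay : ℕ → Ω → Fin M → Fin n → Fin M → ℕ) (t : ℕ) (ω : Ω) (a : Fin M) (i : Fin n) :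
    Params d :=
  delayedParams (fun r => w r ω) t (delay t ω a i)

namespace IsRun

variable {M n : ℕ} {d : Fin (M + 1) → ℕ} {V : VFLProblem.{u} M n d} {p : Fin M → ℝ}
  {q : Fin n → ℝ} {K s g π η μ : ℝ} {D : ℕ} {Ω : Type v} {mΩ : MeasurableSpace Ω} {P : Measure Ω}
  {ℱ : Filtration ℕ mΩ} {act : ℕ → Ω → Fin M} {smp : ℕ → Ω → Fin n}
  {dir : ℕ → Ω → (m : Fin M) → Block (d m.succ)}
  {delay : ℕ → Ω → Fin M → Fin n → Fin M → ℕ} {w : ℕ → Ω → Params d}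

theorem succ_eq_hybridStep
    (H : IsRun V (fun _ => η) (fun _ => μ) p q P ℱ act smp dir delay w) (t : ℕ) (ω : Ω) :
    w (t + 1) ω = V.hybridStep η μ (w t ω)
      (delayedParams (fun r => w r ω) t (delay t ω (act t ω) (smp t ω))) (act t ω) (smp t ω)
      (dir t ω (act t ω)) := by
  ext1 k
  refine Fin.cases ?_ (fun k => ?_) k
  · rw [H.server_step, VFLProblem.hybridStep, setBlock_of_ne _ (Fin.succ_ne_zero _).symm,
      setBlock_same]
  · by_cases hk : k = act t ω
    · subst hk
      rw [H.client_step, VFLProblem.hybridStep, setBlock_same]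
    · rw [H.idle_step t ω k hk, VFLProblem.hybridStep,
        setBlock_of_ne _ (fun h => hk (Fin.succ_injective _ h)),
        setBlock_of_ne _ (Fin.succ_ne_zero _)]

theorem measurable_choice
    (H : IsRun V (fun _ => η) (fun _ => μ) p q P ℱ act smp dir delay w) (t : ℕ) :
    Measurable[ℱ (t + 1)] fun ω => (act t ω, smp t ω) :=
  (H.act_measurable t).prodMk (H.smp_measurable t)

theorem measurable_dir_apply
    (H : IsRun V (fun _ => η) (fun _ => μ) p q P ℱ act smp dir delay w) (t : ℕ) (a : Fin M) :
    Measurable[ℱ (t + 1)] fun ω => dir t ω a :=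
  (measurable_pi_apply a).comp (H.dir_measurable t)

/-- The parameters of a run are adapted. -/
theorem measurable_params
    (H : IsRun V (fun _ => η) (fun _ => μ) p q P ℱ act smp dir delay w)
    (hV : V.UniformBounds p q K s g π D) (t : ℕ) : Measurable[ℱ t] (w t) := by
  induction t using Nat.strong_induction_on with
  | _ t ih =>
    cases t with
    | zero => exact H.init_measurable
    | succ t =>
      have hw : ∀ r ≤ t, Measurable[ℱ (t + 1)] (w r) := fun r hr =>
        (ih r (by omega)).mono (ℱ.mono (by omega)) le_rfl
      have hstale : ∀ a i, Measurable[ℱ (t + 1)] fun ω => staleParams w delay t ω a i := fun a i =>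
        measurable_delayedParams (m := ℱ (t + 1)) hw fun k =>
          (H.delay_measurable t a i k).mono (ℱ.mono (by omega)) le_rfl
      have hai : ∀ c : Fin M × Fin n, Measurable[ℱ (t + 1)] fun ω =>
          V.hybridStep η μ (w t ω) (staleParams w delay t ω c.1 c.2) c.1 c.2 (dir t ω c.1) := fun c =>
        (hV.continuous_hybridStep c.1 c.2).measurable.comp
          (((hw t le_rfl).prodMk (hstale c.1 c.2)).prodMk (H.measurable_dir_apply t c.1))
      have h' : w (t + 1) = fun ω => V.hybridStep η μ (w t ω)
          (staleParams w delay t ω (act t ω) (smp t ω)) (act t ω) (smp t ω) (dir t ω (act t ω)) :=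
        funext fun ω => H.succ_eq_hybridStep t ω
      rw [h']
      exact measurable_of_countable_choice (m := ℱ (t + 1)) (H.measurable_choice t) hai

theorem measurable_state
    (H : IsRun V (fun _ => η) (fun _ => μ) p q P ℱ act smp dir delay w)
    (hV : V.UniformBounds p q K s g π D) (t : ℕ) (a : Fin M) (i : Fin n) :
    Measurable[ℱ t] fun ω => (w t ω, staleParams w delay t ω a i) :=
  (H.measurable_params hV t).prodMk (measurable_delayedParams (m := ℱ t)
    (fun r hr => (H.measurable_params hV r).mono (ℱ.mono hr) le_rfl)
    fun k => H.delay_measurable t a i k)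

theorem measure_choice_eq [IsProbabilityMeasure P]
    (H : IsRun V (fun _ => η) (fun _ => μ) p q P ℱ act smp dir delay w) (t : ℕ) (a : Fin M)
    (i : Fin n) : P ((fun ω => (act t ω, smp t ω)) ⁻¹' {(a, i)}) = ENNReal.ofReal (p a * q i) := by
  have h1 := (H.indep_act_smp t).measure_inter_preimage_eq_mul {a} {i}
    (measurableSet_singleton _) (measurableSet_singleton _)
  have h2 : (fun ω => (act t ω, smp t ω)) ⁻¹' {(a, i)} = act t ⁻¹' {a} ∩ smp t ⁻¹' {i} := by
    ext ω; simp
  have h3 : P (act t ⁻¹' {a}) = ENNReal.ofReal (p a) := by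
    rw [← H.act_law t a, measureReal_def, ENNReal.ofReal_toReal (measure_ne_top _ _)]; rfl
  have h4 : P (smp t ⁻¹' {i}) = ENNReal.ofReal (q i) := by
    rw [← H.smp_law t i, measureReal_def, ENNReal.ofReal_toReal (measure_ne_top _ _)]; rfl
  have hp : 0 ≤ p a := by rw [← H.act_law t a]; exact measureReal_nonneg
  rw [h2, h1, h3, h4, ENNReal.ofReal_mul hp]

/-- On the event that `a` is active with sample `i`, an integral over the past and the
direction of `a` is an iterated integral. -/
theorem setLIntegral_choice [IsProbabilityMeasure P]
    (H : IsRun V (fun _ => η) (fun _ => μ) p q P ℱ act smp dir delay w) (t : ℕ) (a : Fin M)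
    (i : Fin n) {β : Type*} [MeasurableSpace β] {Y : Ω → β} (hY : Measurable[ℱ t] Y)
    {ψ : β × Block (d a.succ) → ENNReal} (hψ : Measurable ψ) :
    ∫⁻ ω in (fun ω => (act t ω, smp t ω)) ⁻¹' {(a, i)}, ψ (Y ω, dir t ω a) ∂P
      = ENNReal.ofReal (p a * q i) * ∫⁻ ω, ∫⁻ x, ψ (Y ω, x) ∂(uniformSphere (d a.succ)) ∂P := by
  have hle : ∀ r, ℱ r ≤ mΩ := ℱ.le
  have hYm : Measurable Y := hY.mono (hle t) le_rfl
  have hc : Measurable fun ω => (act t ω, smp t ω) := (H.measurable_choice t).mono (hle _) le_rfl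
  have hdir : Measurable (dir t) := (H.dir_measurable t).mono (hle _) le_rfl
  have hda : Measurable fun ω => dir t ω a := (measurable_pi_apply a).comp hdir
  have hall : Measurable fun ω => ((act t ω, smp t ω), dir t ω a) := hc.prodMk hda
  -- the choices of the round, with the direction of `a` only, are independent of the past
  have hind : IndepFun Y (fun ω => ((act t ω, smp t ω), dir t ω a)) P := by
    have h1 : IndepFun Y (fun ω => (act t ω, smp t ω, dir t ω)) P :=
      (indep_of_indep_of_le_right (H.indep_past t) hY.comap_le).symm
    exact h1.comp (φ := id)
      (ψ := fun z : Fin M × Fin n × ((m : Fin M) → Block (d m.succ)) => ((z.1, z.2.1), z.2.2 a))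
      measurable_id (by fun_prop)
  have hind2 : IndepFun (fun ω => (act t ω, smp t ω)) (fun ω => dir t ω a) P :=
    (H.indep_dir t).comp (φ := id) measurable_id (measurable_pi_apply a)
  have hlaw : P.map (fun ω => dir t ω a) = uniformSphere (d a.succ) := H.dir_law t a
  set S : Set (Fin M × Fin n) := {(a, i)} with hS
  have hSm : MeasurableSet S := measurableSet_singleton _
  set Φ : β × ((Fin M × Fin n) × Block (d a.succ)) → ENNReal :=
    fun z => (Prod.fst ⁻¹' S).indicator (fun c => ψ (z.1, c.2)) z.2 with hΦ
  have hΦm : Measurable Φ := by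
    have : Φ = ((fun z : β × ((Fin M × Fin n) × Block (d a.succ)) => z.2.1) ⁻¹' S).indicator
        fun z => ψ (z.1, z.2.2) := rfl
    rw [this]
    exact (hψ.comp (by fun_prop)).indicator ((by fun_prop : Measurable _) hSm)
  calc _ = ∫⁻ ω, Φ (Y ω, ((act t ω, smp t ω), dir t ω a)) ∂P := by
        rw [← lintegral_indicator (hc hSm)]; rfl
    _ = ∫⁻ z, Φ z ∂((P.map Y).prod (P.map fun ω => ((act t ω, smp t ω), dir t ω a))) := by
        rw [← (indepFun_iff_map_prod_eq_prod_map_map hYm.aemeasurable hall.aemeasurable).mp hind,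
          lintegral_map hΦm (hYm.prodMk hall)]
    _ = ∫⁻ ω, ∫⁻ ω', Φ (Y ω, ((act t ω', smp t ω'), dir t ω' a)) ∂P ∂P := by
        have := Measure.isProbabilityMeasure_map (μ := P) hall.aemeasurable
        rw [lintegral_prod _ hΦm.aemeasurable,
          lintegral_map hΦm.lintegral_prod_right' hYm]
        refine lintegral_congr fun ω => ?_
        exact lintegral_map (hΦm.comp measurable_prodMk_left) hall
    _ = ∫⁻ ω, ENNReal.ofReal (p a * q i) * ∫⁻ x, ψ (Y ω, x) ∂(uniformSphere (d a.succ)) ∂P := by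
        refine lintegral_congr fun ω => ?_
        have h1 := setLIntegral_of_indepFun hc hda hind2 hSm (h := fun x => ψ (Y ω, x))
          (hψ.comp measurable_prodMk_left)
        rw [← hlaw, ← H.measure_choice_eq t a i, ← h1, ← lintegral_indicator (hc hSm)]
        rfl
    _ = _ := by
        have : IsProbabilityMeasure (uniformSphere (d a.succ)) :=
          hlaw ▸ Measure.isProbabilityMeasure_map hda.aemeasurable
        rw [lintegral_const_mul]
        exact (hψ.lintegral_prod_right').comp hYm

/-- The expectation of a function of the state before a round and of its choices. -/
theorem lintegral_eq_sum_choice [IsProbabilityMeasure P]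
    (H : IsRun V (fun _ => η) (fun _ => μ) p q P ℱ act smp dir delay w)
    (hV : V.UniformBounds p q K s g π D) (t : ℕ)
    {ψ : ∀ a : Fin M, Fin n → (Params d × Params d) × Block (d a.succ) → ENNReal}
    (hψ : ∀ a i, Measurable (ψ a i)) :
    ∫⁻ ω, ψ (act t ω) (smp t ω)
        ((w t ω, staleParams w delay t ω (act t ω) (smp t ω)), dir t ω (act t ω)) ∂P
      = ∑ a, ∑ i, ENNReal.ofReal (p a * q i) *
        ∫⁻ ω, ∫⁻ x, ψ a i ((w t ω, staleParams w delay t ω a i), x) ∂(uniformSphere (d a.succ)) ∂P := by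
  have hc : Measurable fun ω => (act t ω, smp t ω) :=
    (H.measurable_choice t).mono (ℱ.le _) le_rfl
  have hU : (⋃ c : Fin M × Fin n, (fun ω => (act t ω, smp t ω)) ⁻¹' {c}) = Set.univ := by
    ext ω; simp
  rw [← setLIntegral_univ, ← hU, lintegral_iUnion (fun c => hc (measurableSet_singleton c))
    (fun c c' h => Disjoint.preimage _ (by simpa using h)), tsum_fintype, Fintype.sum_prod_type]
  refine Finset.sum_congr rfl fun a _ => Finset.sum_congr rfl fun i _ => ?_
  rw [← H.setLIntegral_choice t a i (H.measurable_state hV t a i) (hψ a i)]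
  refine setLIntegral_congr_fun (hc (measurableSet_singleton _)) fun ω hω => ?_
  obtain ⟨h1, h2⟩ : act t ω = a ∧ smp t ω = i := by simpa using hω
  subst h1 h2
  rfl

theorem sum_ofReal_mul (hV : V.UniformBounds p q K s g π D) :
    ∑ a, ∑ i, ENNReal.ofReal (p a * q i) = 1 := by
  have hp : ∀ a, 0 ≤ p a := fun a => hV.π_pos.le.trans (hV.π_le a)
  have h : ∀ a, ∑ i, ENNReal.ofReal (p a * q i) = ENNReal.ofReal (p a) := fun a => by
    rw [← ENNReal.ofReal_sum_of_nonneg fun i _ => mul_nonneg (hp a) (hV.q_nonneg i),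
      ← Finset.mul_sum, hV.sum_q, mul_one]
  simp_rw [h]
  rw [← ENNReal.ofReal_sum_of_nonneg fun a _ => hp a, hV.sum_p, ENNReal.ofReal_one]

/-! ### The decrease of the objective along a run -/

/-- The clients move little in one round, since the two-point estimator has a bounded second
moment. -/
theorem lintegral_displacement_le [IsProbabilityMeasure P]
    (H : IsRun V (fun _ => η) (fun _ => μ) p q P ℱ act smp dir delay w)
    (hV : V.UniformBounds p q K s g π D) (hμ : 0 < μ) (t : ℕ) :
    ∫⁻ ω, ENNReal.ofReal (∑ m : Fin M, ‖w (t + 1) ω m.succ - w t ω m.succ‖ ^ 2) ∂P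
      ≤ ENNReal.ofReal (η ^ 2 * (2 * D * g ^ 2 + D ^ 2 * K ^ 2 * μ ^ 2 / 2)) := by
  set B := η ^ 2 * (2 * D * g ^ 2 + D ^ 2 * K ^ 2 * μ ^ 2 / 2) with hB
  have h1 : ∀ ω, ∑ m : Fin M, ‖w (t + 1) ω m.succ - w t ω m.succ‖ ^ 2
      = η ^ 2 * ‖V.zoGradient (smp t ω) (act t ω) μ (staleParams w delay t ω (act t ω) (smp t ω))
        (dir t ω (act t ω))‖ ^ 2 := by
    intro ω
    rw [Finset.sum_eq_single (act t ω)]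
    · rw [H.client_step, sub_sub_cancel_left, norm_neg, norm_smul, mul_pow, Real.norm_eq_abs,
        sq_abs]
    · intro m _ hm
      simp [H.idle_step t ω m hm]
    · simp
  simp_rw [h1]
  have hc : ∀ a i, Continuous fun z : (Params d × Params d) × Block (d a.succ) =>
      η ^ 2 * ‖V.zoGradient i a μ z.1.2 z.2‖ ^ 2 := fun a i => by
    have := (hV.continuous_zoGradient (μ := μ) a i).comp
      (f := fun z : (Params d × Params d) × Block (d a.succ) => (z.1.2, z.2)) (by fun_prop)
    exact continuous_const.mul (this.norm.pow 2)
  rw [H.lintegral_eq_sum_choice hV t (ψ := fun a i z =>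
    ENNReal.ofReal (η ^ 2 * ‖V.zoGradient i a μ z.1.2 z.2‖ ^ 2))
    fun a i => (hc a i).measurable.ennreal_ofReal]
  calc _ ≤ ∑ a, ∑ i, ENNReal.ofReal (p a * q i) * ENNReal.ofReal B := by
        refine Finset.sum_le_sum fun a _ => Finset.sum_le_sum fun i _ => ?_
        gcongr
        refine (lintegral_mono (g := fun _ => ENNReal.ofReal B) fun ω => ?_).trans_eq (by simp)
        simp only
        have hcω : Continuous fun x => V.zoGradient i a μ (staleParams w delay t ω a i) x :=
          (hV.continuous_zoGradient a i).comp (f := fun x => (staleParams w delay t ω a i, x)) (by fun_prop)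
        rw [← ofReal_integral_eq_lintegral_ofReal
          (Continuous.integrable_uniformSphere (hV.one_le_dim a) (by fun_prop))
          (Filter.Eventually.of_forall fun x => by positivity), integral_const_mul]
        apply ENNReal.ofReal_le_ofReal
        have h2 := hV.integral_norm_zoGradient_sq_le hμ a i (staleParams w delay t ω a i)
        have h3 := hV.client_gradient i a (staleParams w delay t ω a i)
        rw [hB]
        gcongr
        refine h2.trans ?_
        gcongr
    _ = _ := by
        simp_rw [← Finset.sum_mul]
        rw [sum_ofReal_mul hV, one_mul]

theorem measurable_displacement
    (H : IsRun V (fun _ => η) (fun _ => μ) p q P ℱ act smp dir delay w)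
    (hV : V.UniformBounds p q K s g π D) (t : ℕ) :
    Measurable fun ω => ∑ m : Fin M, ‖w (t + 1) ω m.succ - w t ω m.succ‖ ^ 2 := by
  have hwm : ∀ r, Measurable (w r) := fun r => (H.measurable_params hV r).mono (ℱ.le r) le_rfl
  have hcoord : ∀ r (k : Fin (M + 1)), Measurable fun ω => w r ω k := fun r k =>
    (show Continuous fun x : Params d => x k by fun_prop).measurable.comp (hwm r)
  exact Finset.measurable_sum _ fun m _ =>
    ((hcoord (t + 1) m.succ).sub (hcoord t m.succ)).norm.pow_const 2

/-- The bound of `norm_delayedParams_sub_sq_le` on the error due to the delays, in expectation. -/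
theorem lintegral_delay_error_le [IsProbabilityMeasure P]
    (H : IsRun V (fun _ => η) (fun _ => μ) p q P ℱ act smp dir delay w)
    (hV : V.UniformBounds p q K s g π D) (hμ : 0 < μ) (τ t : ℕ) :
    ∫⁻ ω, ENNReal.ofReal (τ * ∑ r ∈ Finset.Ico (t - τ) t,
        ∑ m : Fin M, ‖w (r + 1) ω m.succ - w r ω m.succ‖ ^ 2) ∂P
      ≤ ENNReal.ofReal (τ ^ 2 * (η ^ 2 * (2 * D * g ^ 2 + D ^ 2 * K ^ 2 * μ ^ 2 / 2))) := by
  have hZm := fun r => (H.measurable_displacement hV r).ennreal_ofReal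
  have h1 : ∀ ω, ENNReal.ofReal (τ * ∑ r ∈ Finset.Ico (t - τ) t,
        ∑ m : Fin M, ‖w (r + 1) ω m.succ - w r ω m.succ‖ ^ 2)
      = ENNReal.ofReal τ * ∑ r ∈ Finset.Ico (t - τ) t, ENNReal.ofReal
        (∑ m : Fin M, ‖w (r + 1) ω m.succ - w r ω m.succ‖ ^ 2) := fun ω => by
    rw [ENNReal.ofReal_mul (by positivity), ENNReal.ofReal_sum_of_nonneg]
    exact fun r _ => Finset.sum_nonneg fun m _ => by positivity
  simp_rw [h1]
  rw [lintegral_const_mul _ (Finset.measurable_sum _ fun r _ => hZm r),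
    lintegral_finsetSum _ fun r _ => hZm r]
  set B := η ^ 2 * (2 * D * g ^ 2 + D ^ 2 * K ^ 2 * μ ^ 2 / 2) with hB
  calc _ ≤ ENNReal.ofReal τ * ∑ r ∈ Finset.Ico (t - τ) t, ENNReal.ofReal B := by
        gcongr with r _
        exact H.lintegral_displacement_le hV hμ r
    _ ≤ ENNReal.ofReal τ * (ENNReal.ofReal τ * ENNReal.ofReal B) := by
        rw [Finset.sum_const, nsmul_eq_mul, Nat.card_Ico]
        gcongr
        rw [ENNReal.ofReal_natCast]
        exact_mod_cast (by omega : t - (t - τ) ≤ τ)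
    _ = _ := by
        rw [← ENNReal.ofReal_mul (by positivity), ← ENNReal.ofReal_mul (by positivity)]
        congr 1; ring

/-- The expected gap after a round, as an expectation over the past of an average over the
choices of the round. -/
theorem lintegral_gap_succ [IsProbabilityMeasure P]
    (H : IsRun V (fun _ => η) (fun _ => μ) p q P ℱ act smp dir delay w)
    (hV : V.UniformBounds p q K s g π D) (t : ℕ) :
    ∫⁻ ω, ENNReal.ofReal (V.objective (w (t + 1) ω) - V.optimalValue) ∂P
      = ∫⁻ ω, ∑ a, ∑ i, ENNReal.ofReal (p a * q i) *
        ∫⁻ x, ENNReal.ofReal (V.objective (V.hybridStep η μ (w t ω)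
          (staleParams w delay t ω a i) a i x) - V.optimalValue)
          ∂(uniformSphere (d a.succ)) ∂P := by
  have hobj : Continuous V.objective := (V.differentiable_objective hV.differentiable).continuous
  have hψ : ∀ a i, Measurable fun z : (Params d × Params d) × Block (d a.succ) =>
      ENNReal.ofReal (V.objective (V.hybridStep η μ z.1.1 z.1.2 a i z.2) - V.optimalValue) :=
    fun a i => ((hobj.comp (hV.continuous_hybridStep a i)).sub
      continuous_const).measurable.ennreal_ofReal
  have hm : ∀ a i, Measurable fun ω => ENNReal.ofReal (p a * q i) *
      ∫⁻ x, ENNReal.ofReal (V.objective (V.hybridStep η μ (w t ω)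
        (staleParams w delay t ω a i) a i x) - V.optimalValue) ∂(uniformSphere (d a.succ)) :=
    fun a i => by
    have := isProbabilityMeasure_uniformSphere (hV.one_le_dim a)
    exact (((hψ a i).lintegral_prod_right').comp
      ((H.measurable_state hV t a i).mono (ℱ.le t) le_rfl)).const_mul _
  rw [lintegral_finsetSum _ fun a _ => Finset.measurable_sum _ fun i _ => hm a i]
  simp_rw [H.succ_eq_hybridStep t]
  rw [H.lintegral_eq_sum_choice hV t hψ]
  refine Finset.sum_congr rfl fun a _ => ?_
  rw [lintegral_finsetSum _ fun i _ => hm a i]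
  refine Finset.sum_congr rfl fun i _ => ?_
  rw [lintegral_const_mul' _ _ ENNReal.ofReal_ne_top]

/-- The expected decrease of the objective in one round. -/
theorem lintegral_objective_succ_add_le [IsProbabilityMeasure P]
    (H : IsRun V (fun _ => η) (fun _ => μ) p q P ℱ act smp dir delay w)
    (hV : V.UniformBounds p q K s g π D) (hη : 0 < η) (hμ : 0 < μ) (hηD : K * η * D ≤ 1 / 4)
    {τ : ℕ} (hτ : ∀ t ω a i m, delay t ω a i m ≤ τ) (t : ℕ) :
    ∫⁻ ω, ENNReal.ofReal (V.objective (w (t + 1) ω) - V.optimalValue) ∂P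
      + ∫⁻ ω, ENNReal.ofReal (η * π / 4 * ‖gradient V.objective (w t ω)‖ ^ 2) ∂P
      ≤ ∫⁻ ω, ENNReal.ofReal (V.objective (w t ω) - V.optimalValue) ∂P
      + ENNReal.ofReal (η * (9 / 4 * K ^ 2 *
          (τ ^ 2 * (η ^ 2 * (2 * D * g ^ 2 + D ^ 2 * K ^ 2 * μ ^ 2 / 2)))
          + D ^ 2 * K ^ 2 * μ ^ 2 / 4 + η * K ^ 3 * D ^ 2 * μ ^ 2 / 4
          + K * η * s ^ 2 + 2 * K * η * D * s ^ 2)) := by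
  have hK := hV.K_pos
  have hwm : ∀ r, Measurable (w r) := fun r => (H.measurable_params hV r).mono (ℱ.le r) le_rfl
  have hobj : Continuous V.objective := (V.differentiable_objective hV.differentiable).continuous
  have hgm : Measurable fun ω =>
      ENNReal.ofReal (η * π / 4 * ‖gradient V.objective (w t ω)‖ ^ 2) := by
    have := (continuous_gradient_of_lipschitz hV.lipschitz_objective).measurable.comp (hwm t)
    exact ((this.norm.pow_const 2).const_mul _).ennreal_ofReal
  have hfm : Measurable fun ω => ENNReal.ofReal (V.objective (w t ω) - V.optimalValue) :=
    ((hobj.measurable.comp (hwm t)).sub_const _).ennreal_ofReal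
  have hδm : Measurable fun ω => ENNReal.ofReal (τ * ∑ r ∈ Finset.Ico (t - τ) t,
      ∑ m : Fin M, ‖w (r + 1) ω m.succ - w r ω m.succ‖ ^ 2) :=
    ((Finset.measurable_sum _ fun r _ =>
      H.measurable_displacement hV r).const_mul _).ennreal_ofReal
  rw [H.lintegral_gap_succ hV, ← lintegral_add_right _ hgm]
  refine (lintegral_mono fun ω => hV.sum_lintegral_gap_add_le hη hμ hηD (w t ω)
    (staleParams w delay t ω) (δ := τ * ∑ r ∈ Finset.Ico (t - τ) t,
      ∑ m : Fin M, ‖w (r + 1) ω m.succ - w r ω m.succ‖ ^ 2)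
    (mul_nonneg (by positivity) (Finset.sum_nonneg fun r _ => Finset.sum_nonneg fun m _ => by
      positivity))
    fun a i => norm_delayedParams_sub_sq_le (fun r => w r ω) t fun m => hτ t ω a i m).trans ?_
  rw [lintegral_add_left hfm, lintegral_add_right _ measurable_const,
    lintegral_const_mul _ hδm, lintegral_const, measure_univ, mul_one]
  gcongr
  refine (add_le_add_left (mul_le_mul_right (H.lintegral_delay_error_le hV hμ τ t) _) _).trans ?_
  rw [← ENNReal.ofReal_mul (by positivity),
    ← ENNReal.ofReal_add (by positivity) (by positivity)]
  exact ENNReal.ofReal_le_ofReal (le_of_eq (by ring))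

/-- The gradients along a run are square integrable, and the sum of their second moments is
controlled by the initial gap and the accumulated errors. -/
theorem integrable_and_sum_integral_le [IsProbabilityMeasure P]
    (H : IsRun V (fun _ => η) (fun _ => μ) p q P ℱ act smp dir delay w)
    (hV : V.UniformBounds p q K s g π D) (hη : 0 < η) (hμ : 0 < μ) (hηD : K * η * D ≤ 1 / 4)
    {τ : ℕ} (hτ : ∀ t ω a i m, delay t ω a i m ≤ τ)
    (h0 : Integrable (fun ω => V.objective (w 0 ω)) P) {R : ℝ}
    (hR : R = η * (9 / 4 * K ^ 2 *
          (τ ^ 2 * (η ^ 2 * (2 * D * g ^ 2 + D ^ 2 * K ^ 2 * μ ^ 2 / 2)))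
          + D ^ 2 * K ^ 2 * μ ^ 2 / 4 + η * K ^ 3 * D ^ 2 * μ ^ 2 / 4
          + K * η * s ^ 2 + 2 * K * η * D * s ^ 2)) (T : ℕ) :
    (∀ t < T, Integrable (fun ω => ‖gradient V.objective (w t ω)‖ ^ 2) P) ∧
    η * π / 4 * ∑ t ∈ Finset.range T, ∫ ω, ‖gradient V.objective (w t ω)‖ ^ 2 ∂P
      ≤ ∫ ω, (V.objective (w 0 ω) - V.optimalValue) ∂P + T * R := by
  have hK := hV.K_pos
  have hR0 : 0 ≤ R := by rw [hR]; positivity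
  have hπ : 0 < η * π / 4 := by have := hV.π_pos; positivity
  have hopt : ∀ W, V.optimalValue ≤ V.objective W := fun W => ciInf_le hV.bddBelow W
  have hΔ0 : 0 ≤ ∫ ω, (V.objective (w 0 ω) - V.optimalValue) ∂P :=
    integral_nonneg fun ω => sub_nonneg.mpr (hopt _)
  set a : ℕ → ENNReal := fun t =>
    ∫⁻ ω, ENNReal.ofReal (V.objective (w t ω) - V.optimalValue) ∂P with ha
  set b : ℕ → ENNReal := fun t =>
    ∫⁻ ω, ENNReal.ofReal (η * π / 4 * ‖gradient V.objective (w t ω)‖ ^ 2) ∂P with hb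
  have hstep : ∀ t, a (t + 1) + b t ≤ a t + ENNReal.ofReal R := by
    intro t
    rw [hR]
    exact H.lintegral_objective_succ_add_le hV hη hμ hηD hτ t
  have htel : ∀ t : ℕ, a t + ∑ r ∈ Finset.range t, b r ≤ a 0 + t * ENNReal.ofReal R := by
    intro t
    induction t with
    | zero => simp
    | succ t ih =>
      rw [Finset.sum_range_succ]
      calc _ = (a (t + 1) + b t) + ∑ r ∈ Finset.range t, b r := by ring
        _ ≤ (a t + ENNReal.ofReal R) + ∑ r ∈ Finset.range t, b r :=
          add_le_add_left (hstep t) _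
        _ = (a t + ∑ r ∈ Finset.range t, b r) + ENNReal.ofReal R := by ring
        _ ≤ (a 0 + t * ENNReal.ofReal R) + ENNReal.ofReal R := by gcongr
        _ = _ := by push_cast; ring
  have ha0 : a 0 = ENNReal.ofReal (∫ ω, (V.objective (w 0 ω) - V.optimalValue) ∂P) :=
    (ofReal_integral_eq_lintegral_ofReal (h0.sub (integrable_const _))
      (Filter.Eventually.of_forall fun ω => sub_nonneg.mpr (hopt _))).symm
  have hsum : ∑ r ∈ Finset.range T, b r
      ≤ ENNReal.ofReal (∫ ω, (V.objective (w 0 ω) - V.optimalValue) ∂P + T * R) := by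
    rw [ENNReal.ofReal_add hΔ0 (by positivity), ENNReal.ofReal_mul (by positivity),
      ENNReal.ofReal_natCast, ← ha0]
    exact le_add_self.trans (htel T)
  have hgm : ∀ t, Measurable fun ω => ‖gradient V.objective (w t ω)‖ ^ 2 := fun t =>
    ((continuous_gradient_of_lipschitz hV.lipschitz_objective).measurable.comp
      ((H.measurable_params hV t).mono (ℱ.le t) le_rfl)).norm.pow_const 2
  have hint : ∀ t < T, Integrable
      (fun ω => η * π / 4 * ‖gradient V.objective (w t ω)‖ ^ 2) P := by
    intro t ht
    refine ⟨((hgm t).const_mul _).aestronglyMeasurable, ?_⟩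
    rw [hasFiniteIntegral_iff_ofReal (Filter.Eventually.of_forall fun ω => by positivity)]
    calc b t ≤ ∑ r ∈ Finset.range T, b r :=
          Finset.single_le_sum (fun _ _ => zero_le) (Finset.mem_range.mpr ht)
      _ ≤ _ := hsum
      _ < ⊤ := ENNReal.ofReal_lt_top
  refine ⟨fun t ht => ?_, ?_⟩
  · exact (integrable_const_mul_iff (IsUnit.mk0 _ hπ.ne') _).mp (hint t ht)
  · have h1 : ∑ r ∈ Finset.range T, b r = ENNReal.ofReal (η * π / 4 *
        ∑ t ∈ Finset.range T, ∫ ω, ‖gradient V.objective (w t ω)‖ ^ 2 ∂P) := by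
      rw [Finset.mul_sum, ENNReal.ofReal_sum_of_nonneg fun t _ =>
        mul_nonneg hπ.le (integral_nonneg fun ω => by positivity)]
      refine Finset.sum_congr rfl fun t ht => ?_
      rw [← integral_const_mul, ofReal_integral_eq_lintegral_ofReal
        (hint t (Finset.mem_range.mp ht)) (Filter.Eventually.of_forall fun ω => by positivity)]
    rw [h1] at hsum
    exact (ENNReal.ofReal_le_ofReal_iff (by positivity)).mp hsum

end IsRun

/-! ### The constants of the problem -/

theorem norm_gradient_objective_sub_le {M n : ℕ} {d : Fin (M + 1) → ℕ} (V : VFLProblem.{u} M n d)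
    (hn : 0 < n) {L : ℝ} (hd : ∀ i, Differentiable ℝ (V.sampleLoss i))
    (hL : ∀ i w w', ‖gradient (V.sampleLoss i) w - gradient (V.sampleLoss i) w'‖ ≤ L * ‖w - w'‖)
    (w w' : Params d) :
    ‖gradient V.objective w - gradient V.objective w'‖ ≤ L * ‖w - w'‖ := by
  have hg : ∀ w, gradient V.objective w
      = (1 / (n : ℝ)) • ∑ i, gradient (V.sampleLoss i) w := by
    intro w
    apply HasGradientAt.gradient
    rw [hasGradientAt_iff_hasFDerivAt, map_smul, map_sum]
    exact (HasFDerivAt.fun_sum fun i _ =>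
      ((hd i) w).hasGradientAt.hasFDerivAt).const_mul (1 / (n : ℝ))
  have hn' : (0 : ℝ) < n := by exact_mod_cast hn
  rw [hg, hg, ← smul_sub, ← Finset.sum_sub_distrib, norm_smul,
    Real.norm_of_nonneg (by positivity)]
  calc _ ≤ (1 / (n : ℝ)) * ∑ _i : Fin n, L * ‖w - w'‖ := by
        gcongr
        exact norm_sum_le_of_le _ fun i _ => hL i w w'
    _ = _ := by
        rw [Finset.sum_const, Finset.card_univ, Fintype.card_fin, nsmul_eq_mul]
        field_simp

/-- The extremal constants `L_*`, `σ_*`, `G_*`, `1 / p_*`, `d_*` bound the problem uniformly. -/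
theorem IsRun.uniformBounds {M n : ℕ} {d : Fin (M + 1) → ℕ} {V : VFLProblem.{u} M n d} {L : ℝ}
    {Lb σ : Fin (M + 1) → ℝ} {G p : Fin M → ℝ} {q : Fin n → ℝ} {η : Fin (M + 1) → ℝ}
    {μ : Fin M → ℝ} {Ω : Type v} {mΩ : MeasurableSpace Ω} {P : Measure Ω}
    [IsProbabilityMeasure P] {ℱ : Filtration ℕ mΩ} {act : ℕ → Ω → Fin M} {smp : ℕ → Ω → Fin n}
    {dir : ℕ → Ω → (m : Fin M) → Block (d m.succ)}
    {delay : ℕ → Ω → Fin M → Fin n → Fin M → ℕ} {w : ℕ → Ω → Params d}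
    (H : IsRun V η μ p q P ℱ act smp dir delay w) (hd : ∀ m : Fin M, 1 ≤ d m.succ)
    (hf : V.FeasibleOptimum) (hL : V.LipschitzGradient L Lb) (hq : V.UnbiasedGradient q)
    (hσ : V.BoundedVariance q σ) (hG : V.BoundedClientGradient G) (hp : ∀ m, 0 < p m) :
    V.UniformBounds p q (maxLipschitz L Lb) (⨆ m, σ m) (⨆ m, G m) (⨅ m, p m)
      (maxClientDim d) := by
  obtain ⟨ω⟩ : Nonempty Ω := nonempty_of_isProbabilityMeasure P
  have : Nonempty (Fin M) := ⟨act 0 ω⟩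
  obtain ⟨hdiff, hlip, hpos, hlipb⟩ := hL
  have hLb : ∀ m, Lb m ≤ maxLipschitz L Lb := fun m =>
    (le_ciSup (Set.finite_range Lb).bddAbove m).trans (le_max_right _ _)
  have hσle : ∀ m, σ m ≤ ⨆ m, σ m := fun m => le_ciSup (Set.finite_range σ).bddAbove m
  -- the law of a random variable with values in a finite type has total mass one
  have hlaw : ∀ {k : ℕ} (X : Ω → Fin k), Measurable X →
      ∑ j, P.real {ω | X ω = j} = 1 := by
    intro k X hX
    exact (sum_measureReal_preimage_singleton (μ := P) (Finset.univ : Finset (Fin k))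
      (f := X) fun j _ => hX (measurableSet_singleton j)).trans (by simp)
  exact
    { K_pos := (hpos 0).trans_le (hLb 0)
      one_le_dim := hd
      dim_le := fun m => le_ciSup (f := fun m : Fin M => d m.succ)
        (Set.finite_range _).bddAbove m
      π_pos := by
        obtain ⟨m, hm⟩ := exists_eq_ciInf_of_finite (f := p)
        rw [← hm]
        exact hp m
      π_le := fun m => ciInf_le (Set.finite_range p).bddBelow m
      sum_p := by
        simp_rw [← H.act_law 0]
        exact hlaw _ ((H.act_measurable 0).mono (ℱ.le _) le_rfl)
      q_nonneg := fun i => by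
        rw [← H.smp_law 0]
        exact measureReal_nonneg
      sum_q := by
        simp_rw [← H.smp_law 0]
        exact hlaw _ ((H.smp_measurable 0).mono (ℱ.le _) le_rfl)
      bddBelow := hf
      differentiable := hdiff
      lipschitz := fun i m w w' => (hlipb i m w w').trans (by gcongr; exact hLb m)
      lipschitz_objective := fun w w' =>
        (norm_gradient_objective_sub_le V (Fin.pos (smp 0 ω)) hdiff hlip w w').trans
          (by gcongr; exact le_max_left _ _)
      unbiased := hq
      variance := fun m w => (hσ.2 m w).trans
        (pow_le_pow_left₀ (hσ.1 m) (hσle m) 2)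
      client_gradient := fun i m w => (hG i m w).trans
        (le_ciSup (Set.finite_range G).bddAbove m) }

/-- With step size `e = 1 / √T`, dividing the telescoped inequality by `T` gives the rate. -/
theorem average_le_of_sum_le {S Δ ps K s g τ D e T R : ℝ} (hT : 0 < T) (he : 0 < e)
    (heT : e ^ 2 * T = 1) (hps : 0 < ps)
    (hR : R = e * (9 / 4 * K ^ 2 *
          (τ ^ 2 * (e ^ 2 * (2 * D * g ^ 2 + D ^ 2 * K ^ 2 * e ^ 2 / 2)))
          + D ^ 2 * K ^ 2 * e ^ 2 / 4 + e * K ^ 3 * D ^ 2 * e ^ 2 / 4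
          + K * e * s ^ 2 + 2 * K * e * D * s ^ 2))
    (hS : e * ps⁻¹ / 4 * S ≤ Δ + T * R) :
    (1 / T) * S ≤ e * (4 * ps * Δ + 4 * ps * K * s ^ 2 + 8 * ps * K * D * s ^ 2)
      + e ^ 2 * (18 * ps * τ ^ 2 * K ^ 2 * D * g ^ 2
        + 5 * ps * τ ^ 2 * e ^ 2 * K ^ 4 * D ^ 2 + ps * K ^ 2 * D ^ 2)
      + e ^ 3 * (ps * K ^ 3 * D ^ 2) := by
  have hT' : 1 / T = e ^ 2 := by field_simp; linarith
  have h1 : e ^ 2 * S = 4 * ps * e * (e * ps⁻¹ / 4 * S) := by field_simp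
  have h2 : 4 * ps * e * (e * ps⁻¹ / 4 * S) ≤ 4 * ps * e * (Δ + T * R) := by gcongr
  have h3 : 4 * ps * e * (Δ + T * R) = 4 * ps * e * Δ + 4 * ps * (e ^ 2 * T) *
      (9 / 4 * K ^ 2 *
          (τ ^ 2 * (e ^ 2 * (2 * D * g ^ 2 + D ^ 2 * K ^ 2 * e ^ 2 / 2)))
          + D ^ 2 * K ^ 2 * e ^ 2 / 4 + e * K ^ 3 * D ^ 2 * e ^ 2 / 4
          + K * e * s ^ 2 + 2 * K * e * D * s ^ 2) := by rw [hR]; ring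
  have h4 : 0 ≤ ps * τ ^ 2 * e ^ 4 * K ^ 4 * D ^ 2 := by positivity
  rw [heT] at h3
  rw [hT', h1]
  linarith

/-- The higher order terms of the rate are absorbed, since `e d_* ≤ 1 / (4 L_*)`. -/
theorem rate_le {Δ ps K s g τ D e : ℝ} (he : 0 < e) (he1 : e ≤ 1) (hps : 0 < ps) (hK : 0 < K)
    (hD : 1 ≤ D) (hΔ : 0 ≤ Δ) (h : K * e * D ≤ 1 / 4) :
    e * (4 * ps * Δ + 4 * ps * K * s ^ 2 + 8 * ps * K * D * s ^ 2)
      + e ^ 2 * (18 * ps * τ ^ 2 * K ^ 2 * D * g ^ 2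
        + 5 * ps * τ ^ 2 * e ^ 2 * K ^ 4 * D ^ 2 + ps * K ^ 2 * D ^ 2)
      + e ^ 3 * (ps * K ^ 3 * D ^ 2)
      ≤ (4 * ps * Δ + 12 * ps * K * s ^ 2 + 18 * ps * τ ^ 2 * K ^ 2 * g ^ 2
        + 5 / 4 * ps * τ ^ 2 * K ^ 3 + ps * K / 4 + ps * K ^ 2 / 4) * (D * e) := by
  have hD0 : 0 < D := by linarith
  have a1 : e * (4 * ps * Δ + 4 * ps * K * s ^ 2) * 1
      ≤ e * (4 * ps * Δ + 4 * ps * K * s ^ 2) * D := by gcongr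
  have a2 : e * 18 * ps * τ ^ 2 * K ^ 2 * D * g ^ 2 * e
      ≤ e * 18 * ps * τ ^ 2 * K ^ 2 * D * g ^ 2 * 1 := by gcongr
  have a3 : 5 * ps * τ ^ 2 * K ^ 3 * D * e * e ^ 2 * (K * e * D)
      ≤ 5 * ps * τ ^ 2 * K ^ 3 * D * e * 1 ^ 2 * (1 / 4) := by gcongr
  have a4 : ps * K * D * e * (K * e * D) ≤ ps * K * D * e * (1 / 4) := by gcongr
  have a5 : ps * K ^ 2 * D * e * e * (K * e * D) ≤ ps * K ^ 2 * D * e * 1 * (1 / 4) := by gcongr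
  linarith

theorem corollary1 :
    ∃ C : ℝ → ℝ → ℝ → ℝ → ℝ → ℕ → ℝ,
    ∀ (M n : ℕ) (d : Fin (M + 1) → ℕ) (_ : ∀ m : Fin M, 1 ≤ d m.succ)
      (V : VFLProblem.{u} M n d)
      (L : ℝ) (Lb σ : Fin (M + 1) → ℝ) (G p : Fin M → ℝ) (q : Fin n → ℝ) (τ : ℕ)
      (_ : V.FeasibleOptimum) (_ : V.LipschitzGradient L Lb) (_ : V.UnbiasedGradient q)
      (_ : V.BoundedVariance q σ) (_ : V.BoundedClientGradient G) (_ : ∀ m, 0 < p m)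
      (Ω : Type v) (mΩ : MeasurableSpace Ω) (P : Measure Ω) (_ : IsProbabilityMeasure P)
      (ℱ : Filtration ℕ mΩ) (act : ℕ → Ω → Fin M) (smp : ℕ → Ω → Fin n)
      (dir : ℕ → Ω → (m : Fin M) → Block (d m.succ))
      (delay : ℕ → Ω → Fin M → Fin n → Fin M → ℕ) (w : ℕ → Ω → Params d)
      (T : ℕ) (_ : 1 ≤ T) (η μ : ℝ) (_ : η = 1 / √(T : ℝ)) (_ : μ = 1 / √(T : ℝ))
      (Ls ds ps σs Gs Δ : ℝ)
      (_ : Ls = maxLipschitz L Lb) (_ : ds = maxClientDim d) (_ : ps = invMinProb p)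
      (_ : σs = ⨆ m, σ m) (_ : Gs = ⨆ m, G m)
      (_ : Δ = ∫ ω, (V.objective (w 0 ω) - V.optimalValue) ∂P)
      (_ : η ≤ 1 / (4 * Ls * ds))
      (_ : IsRun V (fun _ => η) (fun _ => μ) p q P ℱ act smp dir delay w)
      (_ : ∀ t ω a i m, delay t ω a i m ≤ τ)
      (_ : Integrable (fun ω => V.objective (w 0 ω)) P),
      (∀ t < T, Integrable (fun ω => ‖gradient V.objective (w t ω)‖ ^ 2) P) ∧
      (1 / (T : ℝ)) * ∑ t ∈ Finset.range T, ∫ ω, ‖gradient V.objective (w t ω)‖ ^ 2 ∂P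
        ≤ 1 / √(T : ℝ) * (4 * ps * Δ + 4 * ps * Ls * σs ^ 2 + 8 * ps * Ls * ds * σs ^ 2)
          + 1 / (T : ℝ) * (18 * ps * τ ^ 2 * Ls ^ 2 * ds * Gs ^ 2
              + 5 * ps * τ ^ 2 * μ ^ 2 * Ls ^ 4 * ds ^ 2 + ps * Ls ^ 2 * ds ^ 2)
          + 1 / (T : ℝ) ^ (3 / 2 : ℝ) * (ps * Ls ^ 3 * ds ^ 2) ∧
      (1 / (T : ℝ)) * ∑ t ∈ Finset.range T, ∫ ω, ‖gradient V.objective (w t ω)‖ ^ 2 ∂P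
        ≤ C ps Δ Ls σs Gs τ * (ds / √(T : ℝ)) := by
  refine ⟨fun ps Δ K s g τ => 4 * ps * Δ + 12 * ps * K * s ^ 2 + 18 * ps * τ ^ 2 * K ^ 2 * g ^ 2
    + 5 / 4 * ps * τ ^ 2 * K ^ 3 + ps * K / 4 + ps * K ^ 2 / 4, ?_⟩
  intro M n d hd V L Lb σ G p q τ hf hL hq hσ hG hp Ω mΩ P hP ℱ act smp dir delay w T hT η μ hη hμ
    Ls ds ps σs Gs Δ hLs hds hps hσs hGs hΔ hηle H hτ h0
  have hV := H.uniformBounds hd hf hL hq hσ hG hp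
  obtain ⟨ω⟩ : Nonempty Ω := nonempty_of_isProbabilityMeasure P
  have hD1 : 1 ≤ ds := by
    rw [hds]
    exact_mod_cast (hd (act 0 ω)).trans (hV.dim_le (act 0 ω))
  have hps0 : 0 < ps := by
    rw [hps]
    exact inv_pos.mpr hV.π_pos
  have hπ : ⨅ m, p m = ps⁻¹ := by rw [hps, invMinProb, inv_inv]
  rw [← hLs, ← hσs, ← hGs, hπ] at hV
  have hK := hV.K_pos
  have hT0 : (0 : ℝ) < T := by exact_mod_cast hT
  have hη0 : 0 < η := by rw [hη]; positivity
  have hηsq : η ^ 2 = 1 / T := by rw [hη, div_pow, Real.sq_sqrt hT0.le, one_pow]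
  have hη1 : η ≤ 1 := by
    rw [hη, div_le_one (by positivity)]
    exact Real.one_le_sqrt.mpr (by exact_mod_cast hT)
  have hT32 : 1 / (T : ℝ) ^ (3 / 2 : ℝ) = η ^ 3 := by
    rw [hη, div_pow, one_pow, Real.sqrt_eq_rpow, ← Real.rpow_natCast, ← Real.rpow_mul hT0.le]
    norm_num
  have hηD : Ls * η * ds ≤ 1 / 4 := by
    have h := (le_div_iff₀ (by positivity)).mp hηle
    linarith
  have hΔ0 : 0 ≤ Δ := by
    rw [hΔ]
    exact integral_nonneg fun ω => sub_nonneg.mpr (ciInf_le hf _)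
  have hμη : μ = η := hμ.trans hη.symm
  subst hμη
  obtain ⟨hint, hsum⟩ := H.integrable_and_sum_integral_le hV hη0 hη0 (by rwa [← hds]) hτ h0 rfl T
  rw [← hds, ← hΔ] at hsum
  have hrate := average_le_of_sum_le hT0 hη0 (by rw [hηsq]; field_simp) hps0 rfl hsum
  refine ⟨hint, ?_, hrate.trans ?_⟩
  · rw [← hηsq] at hrate
    rwa [← hη, ← hηsq, hT32]
  · have h := rate_le (s := σs) (g := Gs) (τ := (τ : ℝ)) hη0 hη1 hps0 hK hD1 hΔ0 hηD
    rwa [div_eq_mul_one_div ds, ← hη]
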